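/- **Setting.** Let $d\ge 1$ and let $f:\mathbb R^d\to\mathbb R$ be continuously differentiable with a unique global minimizer $x^*$; write $f^*=f(x^*)$. Let $\mu>0$, $L>0$, $a\in(0,1]$, and assume that for all $x,y\in\mathbb R^d$ - (PL) $\|\nabla f(x)\|^2\ge 2\mu\,(f(x)-f^*)$, - (aiming condition) $\langle\nabla f(x),x-x^*\rangle\ge a\,\|\nabla f(x)\|\,\|x-x^*\|$, - ($L$-smoothness) $f(x)-f(y)-\langle\nabla f(y),x-y\rangle\le\frac L2\|x-y\|^2$. Let $\mu_0=\sup\{m\ge\mu:\ f(x)-f^*\ge\frac m2\|x-x^*\|^2\ \forall x\}$ and $L_0=\inf\{0<M\le L:\ f(x)-f^*\le\frac M2\|x-x^*\|^2\ \forall x\}$. **(i)** Let $\gamma\ge0$, $\gamma'=(\mu_0L_0)^{-1/4}$, $\eta=(\mu_0L_0)^{1/4}$, $\eta'=a(\mu_0/L_0)^{1/4}\sqrt\mu$, and let $(x_t,z_t)_{t\ge0}$ with $x_0=z_0$ solve $$\dot x_t=\eta(z_t-x_t)-\gamma\nabla f(x_t),\qquad \dot z_t=\eta'(x_t-z_t)-\gamma'\nabla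 f(x_t).$$ Then for all $t\ge0$ $$f(x_t)-f^*\le\Bigl(1+\sqrt{L_0/\mu_0}\Bigr)(f(x_0)-f^*)\,e^{-a(\mu_0/L_0)^{1/4}\sqrt\mu\,t}.$$ **(ii)** Let $(T_k)_{k\ge 0}$ be random times such that the increments $T_{k+1}-T_k$, $k\ge0$, are i.i.d. exponential of parameter $1$. Let $\gamma=\frac1L$, $\gamma'=\frac1{(\mu_0L_0)^{1/4}\sqrt L}$, $\eta=\frac{(\mu_0L_0)^{1/4}}{\sqrt L}$, $\eta'=a(\mu_0/L_0)^{1/4}\sqrt{\mu/L}$, and $$\alpha_k=\tfrac{\eta}{\eta+\eta'}\bigl(1-e^{-(\eta+\eta')(T_{k+1}-T_k)}\bigr),\qquad \beta_k=\eta'\,\frac{1-e^{-(\eta+\eta')(T_{k+1}-T_k)}}{\eta'+\eta e^{-(\eta+\eta')(T_{k+1}-T_k)}}.$$ Starting from a deterministic point $\tilde x_0=\tilde z_0$, let $$\tilde y_k=\tilde x_k+\alpha_k(\tilde z_k-\tilde x_k),\quad \tilde x_{k+1}=\tilde y_k-\gamma\nabla f(\tilde y_k),\quad \tilde z_{k+1}=\tilde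 z_k+\beta_k(\tilde y_k-\tilde z_k)-\gamma'\nabla f(\tilde y_k).$$ Then for every $c_0>1$, $c_1\in(0,1)$ and $k\in\mathbb N$, with probability at least $1-\frac1{c_0}-e^{-(c_1-1-\log c_1)k}$, $$f(\tilde x_k)-f^*\le c_0\Bigl(1+\sqrt{L_0/\mu_0}\Bigr)(f(\tilde x_0)-f^*)\,e^{-a(\mu_0/L_0)^{1/4}\sqrt{\mu/L}\,(1-c_1)k}.$$ **(iii)** More generally, let $\rho\ge1$ and let $\nabla f(x,\xi)$, with $\xi$ of law $\mathcal P$, be a stochastic gradient (jointly measurable in $(x,\xi)$) satisfying, for all $x$, $\mathbb E_\xi[\nabla f(x,\xi)]=\nabla f(x)$ and $\mathbb E_\xi\|\nabla f(x,\xi)\|^2\le\rho\|\nabla f(x)\|^2$. Let $\xi_0,\xi_1,\dots$ be i.i.d. of law $\mathcal P$ and $(T_k)_{k\ge 0}$ as in (ii), such that the variables $T_{k+1}-T_k$ and $\xi_k$, $k\ge0$, are all mutually independent. Run the method of (ii) with $\nabla f(\tilde y_k)$ replaced by $\nabla f(\tilde y_k,\xi_k)$ and with $\gamma=\frac1{\rho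 L}$, $\gamma'=\frac1\rho\frac1{(\mu_0L_0)^{1/4}\sqrt L}$, $\eta=\frac1\rho\frac{(\mu_0L_0)^{1/4}}{\sqrt L}$, $\eta'=\frac a\rho(\mu_0/L_0)^{1/4}\sqrt{\mu/L}$. Then for every $c_0>1$, $c_1\in(0,1)$ and $k\in\mathbb N$, with probability at least $1-\frac1{c_0}-e^{-(c_1-1-\log c_1)k}$, $$f(\tilde x_k)-f^*\le c_0\Bigl(1+\sqrt{L_0/\mu_0}\Bigr)(f(\tilde x_0)-f^*)\,e^{-\frac a\rho(\mu_0/L_0)^{1/4}\sqrt{\mu/L}\,(1-c_1)k}.$$ -/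

import Mathlib

open MeasureTheory ProbabilityTheory
open scoped Gradient

/-- The Euclidean space `ℝ^d`. -/
abbrev Euc (d : ℕ) : Type := EuclideanSpace ℝ (Fin d)

/-- `xs` is the unique global minimizer of `f`; the minimal value of `f` is then `f xs`. -/
def IsUniqueMinimizer {d : ℕ} (f : Euc d → ℝ) (xs : Euc d) : Prop :=
  (∀ x, f xs ≤ f x) ∧ ∀ y, (∀ x, f y ≤ f x) → y = xs

/-- `L`-smoothness, as a quadratic upper bound around every point. -/
def IsLSmooth {d : ℕ} (f : Euc d → ℝ) (L : ℝ) : Prop :=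
  ∀ x y, f x - f y - inner ℝ (∇ f y) (x - y) ≤ L / 2 * ‖x - y‖ ^ 2

/-- The Polyak-Lojasiewicz inequality with constant `μ`, for `f` minimal at `xs`. -/
def IsPL {d : ℕ} (f : Euc d → ℝ) (xs : Euc d) (μ : ℝ) : Prop :=
  ∀ x, 2 * μ * (f x - f xs) ≤ ‖∇ f x‖ ^ 2

/-- The aiming condition with constant `a`, towards the minimizer `xs`. -/
def IsAiming {d : ℕ} (f : Euc d → ℝ) (xs : Euc d) (a : ℝ) : Prop :=
  ∀ x, a * ‖∇ f x‖ * ‖x - xs‖ ≤ inner ℝ (∇ f x) (x - xs)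

/-- Quadratic lower growth: `f - f* ≥ (m / 2) ‖x - x*‖²`. -/
def QGLower {d : ℕ} (f : Euc d → ℝ) (xs : Euc d) (m : ℝ) : Prop :=
  ∀ x, m / 2 * ‖x - xs‖ ^ 2 ≤ f x - f xs

/-- Quadratic upper growth: `f - f* ≤ (M / 2) ‖x - x*‖²`. -/
def QGUpper {d : ℕ} (f : Euc d → ℝ) (xs : Euc d) (M : ℝ) : Prop :=
  ∀ x, f x - f xs ≤ M / 2 * ‖x - xs‖ ^ 2

/-- The best lower quadratic growth constant `sup {m ≥ μ : f has lower growth m}`. -/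
noncomputable def bestQGLower {d : ℕ} (f : Euc d → ℝ) (xs : Euc d) (μ : ℝ) : ℝ :=
  sSup {m : ℝ | μ ≤ m ∧ QGLower f xs m}

/-- The best upper quadratic growth constant `inf {0 < M ≤ L : f has upper growth M}`. -/
noncomputable def bestQGUpper {d : ℕ} (f : Euc d → ℝ) (xs : Euc d) (L : ℝ) : ℝ :=
  sInf {M : ℝ | 0 < M ∧ M ≤ L ∧ QGUpper f xs M}

/-- `(x, z)` solves the Nesterov momentum ODE with constant parameters on `[0, ∞)`
(the derivative at time `0` is the right derivative). -/
def IsNesterovODE {d : ℕ} (f : Euc d → ℝ) (η η' γ γ' : ℝ) (x z : ℝ → Euc d) : Prop :=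
  ∀ t : ℝ, 0 ≤ t →
    HasDerivWithinAt x (η • (z t - x t) - γ • ∇ f (x t)) (Set.Ici 0) t ∧
    HasDerivWithinAt z (η' • (x t - z t) - γ' • ∇ f (x t)) (Set.Ici 0) t

/-- `(x, y, z)` is a run of Nesterov's momentum method with momentum parameters `α k`, `β k`
and step sizes `γ`, `γ'`, where the `k`-th step uses the gradient oracle `G k`. -/
def IsNesterovRun {d : ℕ} (G : ℕ → Euc d → Euc d) (α β : ℕ → ℝ) (γ γ' : ℝ)
    (x y z : ℕ → Euc d) : Prop :=
  ∀ k : ℕ,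
    y k = x k + α k • (z k - x k) ∧
    x (k + 1) = y k - γ • G k (y k) ∧
    z (k + 1) = z k + β k • (y k - z k) - γ' • G k (y k)

/-- The continuized parameter `α_k`, as a function of the waiting time `s = T_{k+1} - T_k`. -/
noncomputable def continuizedAlpha (η η' s : ℝ) : ℝ :=
  η / (η + η') * (1 - Real.exp (-(η + η') * s))

/-- The continuized parameter `β_k`, as a function of the waiting time `s = T_{k+1} - T_k`. -/
noncomputable def continuizedBeta (η η' s : ℝ) : ℝ :=
  η' * (1 - Real.exp (-(η + η') * s)) / (η' + η * Real.exp (-(η + η') * s))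

/-- Random times whose successive increments are i.i.d. exponential of parameter `1`. -/
structure IsExpClock {Ω : Type*} [MeasurableSpace Ω] (P : Measure Ω) (T : ℕ → Ω → ℝ) :
    Prop where
  measurable : ∀ k, Measurable (T k)
  law : ∀ k, P.map (fun ω => T (k + 1) ω - T k ω) = expMeasure 1
  indep : iIndepFun (fun k ω => T (k + 1) ω - T k ω) P

/-- Random times with i.i.d. exponential increments, carrying i.i.d. marks `ξ k` of law `ν`,
the marks being independent of the times (a marked Poisson process): the pairs
`(T_{k+1} - T_k, ξ_k)` are independent over `k`, and each pair has independent entries. -/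
structure IsMarkedExpClock {Ω Ξ : Type*} [MeasurableSpace Ω] [MeasurableSpace Ξ]
    (P : Measure Ω) (ν : Measure Ξ) (T : ℕ → Ω → ℝ) (ξ : ℕ → Ω → Ξ) : Prop where
  measurable_time : ∀ k, Measurable (T k)
  measurable_mark : ∀ k, Measurable (ξ k)
  law_time : ∀ k, P.map (fun ω => T (k + 1) ω - T k ω) = expMeasure 1
  law_mark : ∀ k, P.map (ξ k) = ν
  indep_entries : ∀ k, IndepFun (fun ω => T (k + 1) ω - T k ω) (ξ k) P
  indep_pairs : iIndepFun (fun k ω => (T (k + 1) ω - T k ω, ξ k ω)) P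

/-- `g x ξ`, with `ξ` of law `ν`, is an unbiased square-integrable estimator of `∇ f x` that
satisfies the strong growth condition with constant `ρ`. -/
structure IsStrongGrowthOracle {d : ℕ} {Ξ : Type*} [MeasurableSpace Ξ] (f : Euc d → ℝ)
    (ν : Measure Ξ) (g : Euc d → Ξ → Euc d) (ρ : ℝ) : Prop where
  measurable : Measurable (fun p : Euc d × Ξ => g p.1 p.2)
  memLp : ∀ x, MemLp (g x) 2 ν
  unbiased : ∀ x, ∫ s, g x s ∂ν = ∇ f x
  growth : ∀ x, ∫ s, ‖g x s‖ ^ 2 ∂ν ≤ ρ * ‖∇ f x‖ ^ 2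

/-! Both time scales use the energy `f - f* + (δ/2)‖z - x*‖²` with `δ = √(μ₀L₀)`. Put `u = √(2(f -
f*))` and `r = ‖x - x*‖`. Quadratic growth says `√μ₀ r ≤ u ≤ √L₀ r`, so `(u - √μ₀ r)(√L₀ r - u) ≥
0`, whence `u² + δr² ≤ 2√L₀ u r`. By PL and aiming, `a√μ u r` is at most the radial derivative; this
is `lyapunov_le_inner_gradient`.

For the ODE, `δγ' = η` cancels the terms `⟨∇f, z - x*⟩` in the derivative of the energy. What
remains is controlled by that inequality and gives the rate `η'` (`IsNesterovODE.lyapunov_decay`).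

The discrete method follows the flow `x' = η(z - x)`, `z' = η'(x - z)` for an exponential time, then
takes a gradient step. Write `e = η'` and give `f - f*` the weight `1 + lam e`. One step then
contracts the mean energy by `exp (-e)` (`DescentData.lintegral_run_step_le`). If `J s` bounds the
mean energy after a gradient step at time `s`, it is enough to find `H` with `J ≤ H - H'`, since
then the mean of `J` is at most `H 0`. The chosen `H` is `(1 - ke)(f - f*)` along the flow plus an
explicit quadratic. The conditions on it reduce to the scalar inequalities `LyapunovWeights`,
solvable for every `0 < e ≤ 1`.

Independence of state and noise iterates the contraction, and Markov's inequality concludes. No tail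
bound on `T_k` is needed: the exponential term in the probability and the factor `1 - c₁` are pure
slack. -/

/-! ### Quadratic growth and the radial derivative -/

open Filter Topology in
/-- A function on the line that is minimal over `[0, ∞)` at `0` has nonnegative slope there. -/
lemma deriv_nonneg_of_forall_nonneg_le {ψ : ℝ → ℝ} {c : ℝ} (h : HasDerivAt ψ c 0)
    (hmin : ∀ t, 0 ≤ t → ψ 0 ≤ ψ t) : 0 ≤ c := by
  refine ge_of_tendsto h.tendsto_slope_zero_right ?_
  filter_upwards [self_mem_nhdsWithin] with t ht
  have ht' : (0 : ℝ) < t := ht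
  have := hmin t ht'.le
  simp only [zero_add, smul_eq_mul]
  exact mul_nonneg (inv_nonneg.mpr ht'.le) (by linarith)

section Growth

variable {d : ℕ} {f : Euc d → ℝ} {xs : Euc d}

lemma IsUniqueMinimizer.gradient_eq_zero (hxs : IsUniqueMinimizer f xs) : ∇ f xs = 0 := by
  have h : IsLocalMin f xs := Filter.Eventually.of_forall hxs.1
  simp [gradient, h.fderiv_eq_zero]

lemma IsLSmooth.qgUpper {L : ℝ} (hxs : IsUniqueMinimizer f xs) (h : IsLSmooth f L) :
    QGUpper f xs L := by
  intro x
  simpa [hxs.gradient_eq_zero] using h x xs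

open Filter in
/-- The Polyak-Lojasiewicz inequality implies quadratic growth, with any smaller constant: minimize
`√(f - f*) + √(m / 2) ‖· - x‖`. -/
lemma IsPL.qgLower_of_lt {μ m : ℝ} (hf : Differentiable ℝ f) (hxs : IsUniqueMinimizer f xs)
    (h : IsPL f xs μ) (hm : 0 < m) (hmμ : m < μ) : QGLower f xs m := by
  intro x
  set c := √(m / 2) with hc
  have hcpos : 0 < c := Real.sqrt_pos.mpr (by linarith)
  have hcsq : c ^ 2 = m / 2 := Real.sq_sqrt (by linarith)
  have hcont : Continuous fun y => √(f y - f xs) + c * ‖y - x‖ := by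
    have := hf.continuous
    fun_prop
  have hlim : Tendsto (fun y => √(f y - f xs) + c * ‖y - x‖) (cocompact (Euc d)) atTop := by
    have h1 : Tendsto (fun y : Euc d => c * ‖y - x‖) (cocompact (Euc d)) atTop := by
      have := tendsto_norm_cocompact_atTop (E := Euc d)
      have h2 : Tendsto (fun y : Euc d => c * (‖y‖ - ‖x‖)) (cocompact (Euc d)) atTop :=
        (tendsto_atTop_add_const_right _ (-‖x‖) this).const_mul_atTop hcpos
      refine tendsto_atTop_mono (fun y => ?_) h2
      exact mul_le_mul_of_nonneg_left (norm_sub_norm_le y x) hcpos.le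
    exact tendsto_atTop_mono (fun y => by linarith [Real.sqrt_nonneg (f y - f xs)]) h1
  obtain ⟨y, hy⟩ := hcont.exists_forall_le hlim
  -- Off `x*`, PL makes the slope of `√(f - f*)` at least `√(μ/2) > c`, so a move against the
  -- gradient lowers the sum: only `x*` can minimize it.
  have hyxs : y = xs := by
    by_contra hne
    have hFy : 0 < f y - f xs := by
      rcases (hxs.1 y).lt_or_eq with hlt | heq
      · linarith
      · exact absurd (hxs.2 y fun w => heq ▸ hxs.1 w) hne
    set u := ∇ f y with hu
    have hline : HasDerivAt (fun t : ℝ => y - t • u) (-u) 0 := by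
      simpa using (((hasDerivAt_id (0 : ℝ)).smul_const u).const_sub y)
    have hgr : HasDerivAt (fun t : ℝ => f (y - t • u)) (-‖u‖ ^ 2) 0 := by
      have h0 : HasFDerivAt f (InnerProductSpace.toDual ℝ _ u) (y - (0 : ℝ) • u) := by
        rw [zero_smul, sub_zero]
        exact (hf y).hasGradientAt.hasFDerivAt
      have := h0.comp_hasDerivAt (0 : ℝ) hline
      simpa [real_inner_self_eq_norm_sq, Function.comp_def] using this
    have hsq : HasDerivAt (fun t : ℝ => √(f (y - t • u) - f xs)) (-‖u‖ ^ 2 / (2 * √(f y - f xs))) 0 := by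
      have := (hgr.sub_const (f xs)).sqrt (by simpa using hFy.ne')
      simpa using this
    have hder : HasDerivAt (fun t : ℝ => √(f (y - t • u) - f xs) + c * (t * ‖u‖))
        (-‖u‖ ^ 2 / (2 * √(f y - f xs)) + c * ‖u‖) 0 := by
      have := ((hasDerivAt_id (0 : ℝ)).mul_const ‖u‖).const_mul c
      simp only [id, one_mul] at this
      exact hsq.add this
    have hnn := deriv_nonneg_of_forall_nonneg_le hder (fun t ht => by
      have h1 := hy (y - t • u)
      have h2 : ‖y - t • u - x‖ ≤ ‖y - x‖ + t * ‖u‖ := by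
        calc ‖y - t • u - x‖ = ‖(y - x) - t • u‖ := by congr 1; abel
          _ ≤ ‖y - x‖ + ‖t • u‖ := norm_sub_le _ _
          _ = _ := by rw [norm_smul, Real.norm_of_nonneg ht]
      have h3 := mul_le_mul_of_nonneg_left h2 hcpos.le
      simp only [zero_smul, sub_zero, zero_mul, mul_zero, add_zero]
      linarith)
    set p := √(f y - f xs) with hp
    have hppos : 0 < p := Real.sqrt_pos.mpr hFy
    have hpsq : p ^ 2 = f y - f xs := Real.sq_sqrt hFy.le
    have hPLy := h y
    rw [← hu, ← hpsq] at hPLy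
    have hmul : ‖u‖ ^ 2 ≤ 2 * p * c * ‖u‖ := by
      have h1 : -‖u‖ ^ 2 / (2 * p) * (2 * p) = -‖u‖ ^ 2 := by field_simp
      nlinarith [mul_nonneg hnn (by positivity : 0 ≤ 2 * p)]
    have hupos : 0 < ‖u‖ := by
      by_contra hn
      have : ‖u‖ = 0 := le_antisymm (not_lt.mp hn) (norm_nonneg _)
      rw [this] at hPLy
      nlinarith [pow_pos hppos 2]
    have hule : ‖u‖ ≤ 2 * p * c := by nlinarith
    have : ‖u‖ ^ 2 ≤ (2 * p * c) ^ 2 := by gcongr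
    have h4 : (2 * p * c) ^ 2 = 2 * m * p ^ 2 := by rw [mul_pow, hcsq]; ring
    nlinarith [pow_pos hppos 2]
  have hx := hy x
  rw [hyxs] at hx
  simp only [sub_self, Real.sqrt_zero, zero_add, norm_zero, mul_zero, add_zero] at hx
  have h5 : (c * ‖xs - x‖) ^ 2 ≤ √(f x - f xs) ^ 2 := by gcongr
  rw [Real.sq_sqrt (by linarith [hxs.1 x]), mul_pow, hcsq, norm_sub_rev] at h5
  exact h5

/-- Growth is a closed condition on the constant, so `m` may tend to `μ` from below; strictness
served to exclude other minimizers of the auxiliary function. -/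
lemma IsPL.qgLower {μ : ℝ} (hμ : 0 < μ) (hf : Differentiable ℝ f)
    (hxs : IsUniqueMinimizer f xs) (h : IsPL f xs μ) : QGLower f xs μ := by
  intro x
  have hcl : Filter.Tendsto (fun m : ℝ => m / 2 * ‖x - xs‖ ^ 2) (nhdsWithin μ (Set.Iio μ))
      (nhds (μ / 2 * ‖x - xs‖ ^ 2)) :=
    (Continuous.tendsto (by fun_prop) μ).mono_left nhdsWithin_le_nhds
  refine le_of_tendsto hcl ?_
  filter_upwards [Ioo_mem_nhdsLT hμ] with m hm
  exact h.qgLower_of_lt hf hxs hm.1 hm.2 x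

lemma exists_norm_sub_pos (hd : 0 < d) (xs : Euc d) : ∃ x : Euc d, 0 < ‖x - xs‖ := by
  have : Nonempty (Fin d) := ⟨⟨0, hd⟩⟩
  obtain ⟨x, hx⟩ := exists_ne xs
  exact ⟨x, norm_pos_iff.mpr (sub_ne_zero.mpr hx)⟩

lemma QGLower.le_of_qgUpper (hd : 0 < d) {m M : ℝ} (h1 : QGLower f xs m) (h2 : QGUpper f xs M) :
    m ≤ M := by
  obtain ⟨x, hx⟩ := exists_norm_sub_pos hd xs
  have := (h1 x).trans (h2 x)
  have hx2 : 0 < ‖x - xs‖ ^ 2 := by positivity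
  have := le_of_mul_le_mul_right this hx2
  linarith

/-- At each point other than `x*`, growth bounds `m` by a fixed ratio, which passes to the supremum.
In dimension zero the set would be unbounded and the real `sSup` would default to `0`. -/
lemma bestQGLower_spec (hd : 0 < d) {μ L : ℝ} (h1 : QGLower f xs μ) (h2 : QGUpper f xs L) :
    μ ≤ bestQGLower f xs μ ∧ QGLower f xs (bestQGLower f xs μ) := by
  have hne : μ ∈ {m : ℝ | μ ≤ m ∧ QGLower f xs m} := ⟨le_rfl, h1⟩
  refine ⟨le_csSup ⟨L, fun m hm => hm.2.le_of_qgUpper hd h2⟩ hne, fun x => ?_⟩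
  rcases (sq_nonneg ‖x - xs‖).eq_or_lt with h0 | hpos
  · have := h1 x
    rw [← h0] at this ⊢
    simpa using this
  · have : bestQGLower f xs μ ≤ 2 * (f x - f xs) / ‖x - xs‖ ^ 2 := by
      refine csSup_le ⟨μ, hne⟩ fun m hm => ?_
      rw [le_div_iff₀ hpos]
      linarith [hm.2 x]
    rw [le_div_iff₀ hpos] at this
    linarith

lemma bestQGUpper_spec {L : ℝ} (hL : 0 < L) (h2 : QGUpper f xs L) :
    bestQGUpper f xs L ≤ L ∧ QGUpper f xs (bestQGUpper f xs L) := by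
  have hne : L ∈ {M : ℝ | 0 < M ∧ M ≤ L ∧ QGUpper f xs M} := ⟨hL, le_rfl, h2⟩
  refine ⟨csInf_le ⟨0, fun m hm => hm.1.le⟩ hne, fun x => ?_⟩
  rcases (sq_nonneg ‖x - xs‖).eq_or_lt with h0 | hpos
  · have := h2 x
    rw [← h0] at this ⊢
    simpa using this
  · have : 2 * (f x - f xs) / ‖x - xs‖ ^ 2 ≤ bestQGUpper f xs L := by
      refine le_csInf ⟨L, hne⟩ fun m hm => ?_
      rw [div_le_iff₀ hpos]
      linarith [hm.2.2 x]
    rw [div_le_iff₀ hpos] at this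
    linarith

/-- The aiming and Polyak-Lojasiewicz conditions bound the radial derivative below by the
Lyapunov function at `z = x`. -/
lemma lyapunov_le_inner_gradient {μ a μ₀ L₀ : ℝ} (ha : 0 < a)
    (hμ₀ : 0 < μ₀) (hL₀ : μ₀ ≤ L₀) (hPL : IsPL f xs μ) (hAC : IsAiming f xs a)
    (hlo : QGLower f xs μ₀) (hup : QGUpper f xs L₀) (hμ : 0 < μ) (x : Euc d) :
    a * √μ / √L₀ * (f x - f xs + √(μ₀ * L₀) / 2 * ‖x - xs‖ ^ 2) ≤
      inner ℝ (∇ f x) (x - xs) := by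
  have hL₀pos : 0 < L₀ := hμ₀.trans_le hL₀
  set r := ‖x - xs‖
  have hr : 0 ≤ r := norm_nonneg _
  have hF : 0 ≤ f x - f xs := le_trans (by positivity) (hlo x)
  set u := √(2 * (f x - f xs)) with hu
  have hu0 : 0 ≤ u := Real.sqrt_nonneg _
  have husq : u ^ 2 = 2 * (f x - f xs) := Real.sq_sqrt (by linarith)
  have hlo' : √μ₀ * r ≤ u := by
    refine Real.le_sqrt_of_sq_le ?_
    rw [mul_pow, Real.sq_sqrt hμ₀.le]
    linarith [hlo x]
  have hup' : u ≤ √L₀ * r := by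
    refine Real.sqrt_le_iff.mpr ⟨by positivity, ?_⟩
    rw [mul_pow, Real.sq_sqrt hL₀pos.le]
    linarith [hup x]
  have hG : √μ * u ≤ ‖∇ f x‖ := by
    refine abs_le_of_sq_le_sq' ?_ (norm_nonneg _) |>.2
    rw [mul_pow, Real.sq_sqrt hμ.le, husq]
    linarith [hPL x]
  have hsqrt : √μ₀ ≤ √L₀ := Real.sqrt_le_sqrt hL₀
  have hLpos : 0 < √L₀ := Real.sqrt_pos.mpr hL₀pos
  -- The product of the two growth gaps gives `(√μ₀ + √L₀) u r` on the right; then `√μ₀ ≤ √L₀`.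
  have hkey : u ^ 2 + √(μ₀ * L₀) * r ^ 2 ≤ 2 * √L₀ * (u * r) := by
    rw [Real.sqrt_mul hμ₀.le]
    nlinarith [mul_nonneg (sub_nonneg.mpr hlo') (sub_nonneg.mpr hup'),
      mul_nonneg (sub_nonneg.mpr hsqrt) (mul_nonneg hu0 hr)]
  calc a * √μ / √L₀ * (f x - f xs + √(μ₀ * L₀) / 2 * r ^ 2)
      = a * √μ / (2 * √L₀) * (u ^ 2 + √(μ₀ * L₀) * r ^ 2) := by rw [husq]; field_simp
    _ ≤ a * √μ / (2 * √L₀) * (2 * √L₀ * (u * r)) := by gcongr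
    _ = a * (√μ * u) * r := by field_simp
    _ ≤ a * ‖∇ f x‖ * r := by gcongr
    _ ≤ _ := hAC x

end Growth

/-! ### Continuous time -/

/-- Lyapunov decay of `f - f* + (δ / 2) ‖z - x*‖²` along the Nesterov ODE. -/
lemma IsNesterovODE.lyapunov_decay {d : ℕ} {f : Euc d → ℝ} {xs : Euc d} (hf : Differentiable ℝ f)
    {η e γ γ' δ : ℝ} (he : 0 ≤ e) (hγ : 0 ≤ γ) (hδ : 0 ≤ δ) (hγ' : δ * γ' = η)
    (hS : ∀ x, e * (f x - f xs + δ / 2 * ‖x - xs‖ ^ 2) ≤ η * inner ℝ (∇ f x) (x - xs))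
    {x z : ℝ → Euc d} (h : IsNesterovODE f η e γ γ' x z) {t : ℝ} (ht : 0 ≤ t) :
    f (x t) - f xs + δ / 2 * ‖z t - xs‖ ^ 2 ≤
      (f (x 0) - f xs + δ / 2 * ‖z 0 - xs‖ ^ 2) * Real.exp (-e * t) := by
  set V : ℝ → ℝ := fun t => f (x t) - f xs + δ / 2 * ‖z t - xs‖ ^ 2 with hV
  have hder : ∀ t, 0 ≤ t → HasDerivWithinAt (fun t => V t * Real.exp (e * t))
      ((inner ℝ (∇ f (x t)) (η • (z t - x t) - γ • ∇ f (x t)) +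
        δ / 2 * (2 * inner ℝ (z t - xs) (e • (x t - z t) - γ' • ∇ f (x t)))) * Real.exp (e * t) +
        V t * (Real.exp (e * t) * e)) (Set.Ici 0) t := by
    intro t ht
    obtain ⟨h1, h2⟩ := h t ht
    have hfx : HasDerivWithinAt (fun t => f (x t))
        (inner ℝ (∇ f (x t)) (η • (z t - x t) - γ • ∇ f (x t))) (Set.Ici 0) t :=
      (hf (x t)).hasGradientAt.hasFDerivAt.comp_hasDerivWithinAt t h1
    have hz : HasDerivWithinAt (fun t => ‖z t - xs‖ ^ 2)
        (2 * inner ℝ (z t - xs) (e • (x t - z t) - γ' • ∇ f (x t))) (Set.Ici 0) t :=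
      (h2.sub_const xs).norm_sq
    have hexp : HasDerivWithinAt (fun t => Real.exp (e * t)) (Real.exp (e * t) * e)
        (Set.Ici 0) t := by
      simpa using (((hasDerivAt_id t).const_mul e).exp).hasDerivWithinAt
    exact ((hfx.sub_const (f xs)).add (hz.const_mul (δ / 2))).mul hexp
  have hanti : AntitoneOn (fun t => V t * Real.exp (e * t)) (Set.Ici 0) := by
    refine antitoneOn_of_hasDerivWithinAt_nonpos (convex_Ici 0)
      (fun t ht => (hder t ht).continuousWithinAt)
      (fun t ht => (hder t (interior_subset ht)).mono interior_subset) fun t _ => ?_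
    have hexp := Real.exp_pos (e * t)
    suffices hle : inner ℝ (∇ f (x t)) (η • (z t - x t) - γ • ∇ f (x t)) +
        δ / 2 * (2 * inner ℝ (z t - xs) (e • (x t - z t) - γ' • ∇ f (x t))) + e * V t ≤ 0 by
      nlinarith
    have hS' := hS (x t)
    simp only [hV]
    set G := ∇ f (x t)
    have e1 : z t - x t = (z t - xs) - (x t - xs) := by abel
    have e2 : x t - z t = (x t - xs) - (z t - xs) := by abel
    rw [e1, e2]
    generalize z t - xs = Z at *
    generalize x t - xs = X at *
    have hZX : inner ℝ Z X ≤ ‖Z‖ ^ 2 / 2 + ‖X‖ ^ 2 / 2 := by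
      have := norm_sub_sq_real Z X
      nlinarith [sq_nonneg ‖Z - X‖]
    simp only [inner_sub_right, inner_smul_right, real_inner_self_eq_norm_sq]
    rw [real_inner_comm G Z]
    have h3 := mul_le_mul_of_nonneg_left hZX (mul_nonneg hδ he)
    have h4 : 0 ≤ γ * ‖G‖ ^ 2 := by positivity
    -- With `η = δγ'` the two occurrences of `⟨∇f, z - x*⟩` cancel.
    rw [← hγ'] at hS' ⊢
    linarith
  have h0 := hanti (Set.mem_Ici.mpr le_rfl) (Set.mem_Ici.mpr ht) ht
  simp only [mul_zero, Real.exp_zero, mul_one] at h0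
  have hexp := Real.exp_pos (-e * t)
  calc V t = V t * Real.exp (e * t) * Real.exp (-e * t) := by
        rw [mul_assoc, ← Real.exp_add]; simp
    _ ≤ V 0 * Real.exp (-e * t) := by gcongr

/-! ### Scalar weights of the discrete analysis -/

/-- The Taylor remainder is at most `e⁵/100 ≤ e⁴/100`, and `1/24 - 1/100 > 1/32`. -/
lemma exp_neg_ge_quartic {e : ℝ} (h0 : 0 ≤ e) (h1 : e ≤ 1) :
    1 - e + e ^ 2 / 2 - e ^ 3 / 6 + e ^ 4 / 32 ≤ Real.exp (-e) := by
  have h := Real.exp_bound (x := -e) (by rw [abs_neg, abs_of_nonneg h0]; exact h1) (n := 5)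
    (by norm_num)
  rw [abs_neg, abs_of_nonneg h0] at h
  simp only [Finset.sum_range_succ, Finset.sum_range_zero, Nat.factorial] at h
  have h2 := (abs_le.mp h).1
  norm_num at h2
  have : e ^ 5 ≤ e ^ 4 := pow_le_pow_of_le_one h0 h1 (by norm_num)
  nlinarith [pow_nonneg h0 4]

/-- The weights of the discrete Lyapunov analysis, at momentum parameter `e`. -/
structure LyapunovWeights (e lam k A B : ℝ) : Prop where
  lam_nonneg : 0 ≤ lam
  k_nonneg : 0 ≤ k
  A_nonneg : 0 ≤ A
  B_nonneg : 0 ≤ B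
  -- `young`, `excess_nonneg` and `descent` yield `J ≤ H - H'`; `value` and `dist` compare `H 0`
  -- with the initial energy, `s` standing for `1 + η + e`.
  young : k ^ 2 ≤ A * B
  excess_nonneg : 0 ≤ k - 1 + lam
  descent : B * e ^ 2 + (k - 1 + lam) ≤ lam * e ^ 2
  value : 1 - k * e ≤ Real.exp (-e) * (1 + lam * e)
  dist : ∀ s, 1 + 2 * e ≤ s →
    e ^ 3 * (2 * s - 1) ≤ (Real.exp (-e) - 1 + e) * (s * ((1 - A) * s + 2 * e ^ 2))

/-- In `t = s - (1 + 2e)` the gap is a quadratic with nonnegative leading coefficient, so its value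
and slope at `t = 0` decide. The quadratic in `e` bounds `(exp (-e) - 1 + e)/e²` from below. -/
lemma dist_weight_of_poly {e A : ℝ} (h0 : 0 < e) (h1 : e ≤ 1) (hA : A ≤ 1)
    (hderiv : 2 * e ≤ (1 / 2 - e / 6 + e ^ 2 / 32) * (2 * (1 - A) * (1 + 2 * e) + 2 * e ^ 2))
    (hval : e * (1 + 4 * e) ≤ (1 / 2 - e / 6 + e ^ 2 / 32) *
      ((1 + 2 * e) * ((1 - A) * (1 + 2 * e) + 2 * e ^ 2))) (s : ℝ) (hs : 1 + 2 * e ≤ s) :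
    e ^ 3 * (2 * s - 1) ≤ (Real.exp (-e) - 1 + e) * (s * ((1 - A) * s + 2 * e ^ 2)) := by
  set h := 1 / 2 - e / 6 + e ^ 2 / 32 with hh
  have hhpos : 0 ≤ h := by nlinarith
  have hexp : e ^ 2 * h ≤ Real.exp (-e) - 1 + e := by
    have := exp_neg_ge_quartic h0.le h1
    have h3 : e ^ 2 * h = e ^ 2 / 2 - e ^ 3 / 6 + e ^ 4 / 32 := by rw [hh]; ring
    linarith
  have hs0 : 0 ≤ s := by linarith
  have hmain : e * (2 * s - 1) ≤ h * (s * ((1 - A) * s + 2 * e ^ 2)) := by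
    obtain ⟨t, ht, rfl⟩ : ∃ t, 0 ≤ t ∧ s = 1 + 2 * e + t := ⟨s - (1 + 2 * e), by linarith, by ring⟩
    have h4 := mul_le_mul_of_nonneg_right hderiv ht
    have h5 : 0 ≤ h * ((1 - A) * t ^ 2) :=
      mul_nonneg hhpos (mul_nonneg (by linarith) (sq_nonneg t))
    linarith
  have hnn : 0 ≤ s * ((1 - A) * s + 2 * e ^ 2) :=
    mul_nonneg hs0 (add_nonneg (mul_nonneg (by linarith) hs0) (by positivity))
  calc e ^ 3 * (2 * s - 1) = e ^ 2 * (e * (2 * s - 1)) := by ring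
    _ ≤ e ^ 2 * (h * (s * ((1 - A) * s + 2 * e ^ 2))) := by gcongr
    _ = e ^ 2 * h * (s * ((1 - A) * s + 2 * e ^ 2)) := by ring
    _ ≤ _ := mul_le_mul_of_nonneg_right hexp hnn

lemma value_weight_of_poly {e lam k : ℝ} (h0 : 0 < e) (h1 : e ≤ 1) (hl : 0 ≤ lam)
    (h : 1 - k * e ≤ (1 - e + e ^ 2 / 2 - e ^ 3 / 6 + e ^ 4 / 32) * (1 + lam * e)) :
    1 - k * e ≤ Real.exp (-e) * (1 + lam * e) :=
  h.trans (mul_le_mul_of_nonneg_right (exp_neg_ge_quartic h0.le h1) (by positivity))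

/-- Since `B = lam` and `k = 1 - lam`, `descent` is an equality. With `lam = 1/2 + ce`, `value` is
tight to second order for every `c`. To leading order its cubic term asks `c ≤ 1/12`, while `young`
asks `c ≥ 1/18`; hence `1/16`. -/
lemma lyapunovWeights_of_small {e : ℝ} (h0 : 0 < e) (h1 : e ≤ 2 / 5) :
    LyapunovWeights e (1 / 2 + e / 16) (1 / 2 - e / 16) (1 / 2 - e / 6) (1 / 2 + e / 16) where
  lam_nonneg := by linarith
  k_nonneg := by linarith
  A_nonneg := by linarith
  B_nonneg := by linarith
  young := by nlinarith
  excess_nonneg := by linarith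
  descent := by nlinarith
  value := value_weight_of_poly h0 (by linarith) (by linarith) (by
    have h2 : 0 ≤ e ^ 3 * (1 / 48 - e / 48 - e ^ 2 / 192) :=
      mul_nonneg (by positivity) (by nlinarith)
    nlinarith [pow_pos h0 5, pow_pos h0 4, pow_pos h0 3])
  dist := dist_weight_of_poly h0 (by linarith) (by linarith)
    (by nlinarith [pow_pos h0 2, pow_pos h0 3, pow_pos h0 4])
    (by nlinarith [pow_pos h0 2, pow_pos h0 3, pow_pos h0 4, pow_pos h0 5,
          mul_nonneg h0.le (sub_nonneg.mpr h1), mul_nonneg (sq_nonneg e) (sub_nonneg.mpr h1)])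

/-- Here `k - 1 + lam = 45/1000`, and `B` is the value making `descent` an equality. -/
lemma lyapunovWeights_of_middle {e : ℝ} (h0 : 2 / 5 ≤ e) (h1 : e ≤ 1 / 2) :
    LyapunovWeights e (65 / 100) (395 / 1000) (71 / 100 - 7 / 10 * e)
      (65 / 100 - 45 / 1000 / e ^ 2) := by
  have hpos : 0 < e := by linarith
  have hB : 65 / 100 - 45 / 1000 / (2 / 5) ^ 2 ≤ 65 / 100 - 45 / 1000 / e ^ 2 := by gcongr
  have hmul : (65 / 100 - 45 / 1000 / e ^ 2) * e ^ 2 = 65 / 100 * e ^ 2 - 45 / 1000 := by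
    field_simp
  refine ⟨by norm_num, by norm_num, by linarith, by linarith, ?_, by norm_num, by linarith,
    value_weight_of_poly hpos (by linarith) (by norm_num) ?_,
    dist_weight_of_poly hpos (by linarith) (by linarith) ?_ ?_⟩
  · have h2 : (395 / 1000) ^ 2 * e ^ 2 ≤
        (71 / 100 - 7 / 10 * e) * (65 / 100 * e ^ 2 - 45 / 1000) := by
      nlinarith [mul_nonneg (sub_nonneg.mpr h0) (sub_nonneg.mpr h1),
        mul_nonneg hpos.le (mul_nonneg (sub_nonneg.mpr h0) (sub_nonneg.mpr h1))]
    rw [← hmul, ← mul_assoc] at h2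
    exact le_of_mul_le_mul_right h2 (by positivity)
  · nlinarith [mul_nonneg (sub_nonneg.mpr h0) (sub_nonneg.mpr h1),
        mul_nonneg hpos.le (mul_nonneg (sub_nonneg.mpr h0) (sub_nonneg.mpr h1)),
        mul_nonneg (pow_pos hpos 2).le (mul_nonneg (sub_nonneg.mpr h0) (sub_nonneg.mpr h1)),
        mul_nonneg (pow_pos hpos 3).le (mul_nonneg (sub_nonneg.mpr h0) (sub_nonneg.mpr h1))]
  · nlinarith [mul_nonneg (sub_nonneg.mpr h0) (sub_nonneg.mpr h1),
        mul_nonneg hpos.le (mul_nonneg (sub_nonneg.mpr h0) (sub_nonneg.mpr h1)),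
        mul_nonneg (pow_pos hpos 2).le (mul_nonneg (sub_nonneg.mpr h0) (sub_nonneg.mpr h1))]
  · nlinarith [mul_nonneg (sub_nonneg.mpr h0) (sub_nonneg.mpr h1),
        mul_nonneg hpos.le (mul_nonneg (sub_nonneg.mpr h0) (sub_nonneg.mpr h1)),
        mul_nonneg (pow_pos hpos 2).le (mul_nonneg (sub_nonneg.mpr h0) (sub_nonneg.mpr h1)),
        mul_nonneg (pow_pos hpos 3).le (mul_nonneg (sub_nonneg.mpr h0) (sub_nonneg.mpr h1))]

/-- Without Young's inequality (`k = 0`), `value` and `descent` ask that `lam` lie between `(exp e -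
1)/e` and `1/(1 - e²)`. This range is empty for small `e`, which is why the other cases need `k >
0`. -/
lemma lyapunovWeights_of_large {e : ℝ} (h0 : 1 / 2 ≤ e) (h1 : e ≤ 1) :
    LyapunovWeights e (13 / 16 + e) 0 0 0 := by
  have hpos : 0 < e := by linarith
  refine ⟨by linarith, le_rfl, le_rfl, le_rfl, by norm_num, by linarith, ?_,
    value_weight_of_poly hpos h1 (by linarith) ?_,
    dist_weight_of_poly hpos h1 (by norm_num) ?_ ?_⟩
  · nlinarith [mul_nonneg (sub_nonneg.mpr h0) (sub_nonneg.mpr h1),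
        mul_nonneg hpos.le (mul_nonneg (sub_nonneg.mpr h0) (sub_nonneg.mpr h1))]
  · nlinarith [mul_nonneg (sub_nonneg.mpr h0) (sub_nonneg.mpr h1),
        mul_nonneg hpos.le (mul_nonneg (sub_nonneg.mpr h0) (sub_nonneg.mpr h1)),
        mul_nonneg (pow_pos hpos 2).le (mul_nonneg (sub_nonneg.mpr h0) (sub_nonneg.mpr h1)),
        mul_nonneg (pow_pos hpos 3).le (mul_nonneg (sub_nonneg.mpr h0) (sub_nonneg.mpr h1)),
        mul_nonneg (pow_pos hpos 4).le (mul_nonneg (sub_nonneg.mpr h0) (sub_nonneg.mpr h1))]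
  · nlinarith [mul_nonneg (sub_nonneg.mpr h0) (sub_nonneg.mpr h1),
        mul_nonneg hpos.le (mul_nonneg (sub_nonneg.mpr h0) (sub_nonneg.mpr h1)),
        mul_nonneg (pow_pos hpos 2).le (mul_nonneg (sub_nonneg.mpr h0) (sub_nonneg.mpr h1))]
  · nlinarith [mul_nonneg (sub_nonneg.mpr h0) (sub_nonneg.mpr h1),
        mul_nonneg hpos.le (mul_nonneg (sub_nonneg.mpr h0) (sub_nonneg.mpr h1)),
        mul_nonneg (pow_pos hpos 2).le (mul_nonneg (sub_nonneg.mpr h0) (sub_nonneg.mpr h1)),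
        mul_nonneg (pow_pos hpos 3).le (mul_nonneg (sub_nonneg.mpr h0) (sub_nonneg.mpr h1))]

lemma exists_lyapunovWeights {e : ℝ} (h0 : 0 < e) (h1 : e ≤ 1) :
    ∃ lam k A B, LyapunovWeights e lam k A B := by
  rcases le_total e (2 / 5) with h | h
  · exact ⟨_, _, _, _, lyapunovWeights_of_small h0 h⟩
  rcases le_total e (1 / 2) with h' | h'
  · exact ⟨_, _, _, _, lyapunovWeights_of_middle h h'⟩
  · exact ⟨_, _, _, _, lyapunovWeights_of_large h' h1⟩

/-! ### Mean contraction over one step -/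

open Filter Topology in
/-- If `e^{-s} H(s) → 0` and `0 ≤ J ≤ H - H'` on `[0, ∞)`, then the mean of `J` at an exponential
time is at most `H 0`. -/
lemma lintegral_expMeasure_le {J H H' : ℝ → ℝ} (hH : ∀ s, HasDerivAt H (H' s) s)
    (hlim : Tendsto (fun s => Real.exp (-s) * H s) atTop (𝓝 0))
    (hnn : ∀ s, 0 ≤ H s - H' s) (hle : ∀ s, J s ≤ H s - H' s) :
    ∫⁻ s, ENNReal.ofReal (J s) ∂(expMeasure 1) ≤ ENNReal.ofReal (H 0) := by
  -- The integrand `e^{-s}(H - H')` is an exact derivative; being nonnegative, it is integrable once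
  -- the primitive has a limit.
  have hder : ∀ s ∈ Set.Ici (0 : ℝ), HasDerivAt (fun s => -(Real.exp (-s) * H s))
      (Real.exp (-s) * (H s - H' s)) s := fun s _ => by
    have h1 : HasDerivAt (fun s : ℝ => Real.exp (-s)) (-Real.exp (-s)) s := by
      simpa using (hasDerivAt_neg s).exp
    refine (h1.mul (hH s)).neg.congr_deriv ?_
    ring
  have hpos : ∀ s ∈ Set.Ioi (0 : ℝ), 0 ≤ Real.exp (-s) * (H s - H' s) := fun s _ =>
    mul_nonneg (Real.exp_pos _).le (hnn s)
  have hlim' : Tendsto (fun s => -(Real.exp (-s) * H s)) atTop (𝓝 0) := by simpa using hlim.neg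
  have hint := integral_Ioi_of_hasDerivAt_of_nonneg' hder hpos hlim'
  have hintble := integrableOn_Ioi_deriv_of_nonneg' hder hpos hlim'
  have hpdf : Measurable (exponentialPDF 1) :=
    (measurable_exponentialPDFReal 1).ennreal_ofReal
  have hzero : ∀ s ∈ Set.Iio (0 : ℝ), exponentialPDF 1 s * ENNReal.ofReal (J s) = 0 := by
    intro s hs
    rw [exponentialPDF_of_neg hs, zero_mul]
  have hform : expMeasure 1 = volume.withDensity (exponentialPDF 1) := rfl
  calc ∫⁻ s, ENNReal.ofReal (J s) ∂(expMeasure 1)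
      ≤ ∫⁻ s, exponentialPDF 1 s * ENNReal.ofReal (J s) := by
        rw [hform]
        exact lintegral_withDensity_le_lintegral_mul _ hpdf _
    _ = ∫⁻ s in Set.Ici 0, exponentialPDF 1 s * ENNReal.ofReal (J s) := by
        rw [← lintegral_add_compl _ measurableSet_Ici (A := Set.Ici (0 : ℝ)), Set.compl_Ici,
          setLIntegral_congr_fun measurableSet_Iio hzero, lintegral_zero, add_zero]
    _ ≤ ∫⁻ s in Set.Ici 0, ENNReal.ofReal (Real.exp (-s) * (H s - H' s)) := by
        refine setLIntegral_mono' measurableSet_Ici fun s hs => ?_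
        rw [exponentialPDF_of_nonneg hs, ← ENNReal.ofReal_mul (by positivity)]
        refine ENNReal.ofReal_le_ofReal ?_
        simp only [one_mul]
        exact mul_le_mul_of_nonneg_left (hle s) (Real.exp_pos _).le
    _ = ∫⁻ s in Set.Ioi 0, ENNReal.ofReal (Real.exp (-s) * (H s - H' s)) :=
        setLIntegral_congr Ioi_ae_eq_Ici.symm
    _ = ENNReal.ofReal (∫ s in Set.Ioi 0, Real.exp (-s) * (H s - H' s)) :=
        (ofReal_integral_eq_lintegral_ofReal hintble
          ((ae_restrict_iff' measurableSet_Ioi).mpr (ae_of_all _ hpos))).symm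
    _ = ENNReal.ofReal (H 0) := by rw [hint]; simp

/-- What the discrete Lyapunov analysis needs to know of the objective and of the parameters. -/
structure DescentData {d : ℕ} (f : Euc d → ℝ) (xs : Euc d) (e η δ ρ L : ℝ) : Prop where
  contDiff : ContDiff ℝ 1 f
  min : ∀ x, f xs ≤ f x
  e_pos : 0 < e
  e_le_one : e ≤ 1
  e_le : e ≤ η
  L_pos : 0 < L
  one_le_rho : 1 ≤ ρ
  delta_eq : δ = η ^ 2 * ρ ^ 2 * L
  smooth : IsLSmooth f L
  aim : ∀ x, e * (f x - f xs + δ / 2 * ‖x - xs‖ ^ 2) ≤ η * inner ℝ (∇ f x) (x - xs)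
  grad : ∀ x, e ^ 2 * (f x - f xs) ≤ ‖∇ f x‖ ^ 2 / (2 * ρ * L)

/-- The Lyapunov function of the discrete analysis. -/
noncomputable def lyapunov {d : ℕ} (f : Euc d → ℝ) (xs : Euc d) (θ δ : ℝ) (x z : Euc d) : ℝ :=
  θ * (f x - f xs) + δ / 2 * ‖z - xs‖ ^ 2

namespace DescentData

variable {d : ℕ} {f : Euc d → ℝ} {xs : Euc d} {e η δ ρ L : ℝ}

lemma differentiable (D : DescentData f xs e η δ ρ L) : Differentiable ℝ f :=
  D.contDiff.differentiable one_ne_zero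

lemma delta_pos (D : DescentData f xs e η δ ρ L) : 0 < δ := by
  have h1 := D.e_pos.trans_le D.e_le
  have h2 := D.L_pos
  have h3 : 0 < ρ := by linarith [D.one_le_rho]
  rw [D.delta_eq]
  positivity

lemma lyapunov_nonneg (D : DescentData f xs e η δ ρ L) {θ : ℝ} (hθ : 0 ≤ θ) (x z : Euc d) :
    0 ≤ lyapunov f xs θ δ x z := by
  have := D.delta_pos
  exact add_nonneg (mul_nonneg hθ (sub_nonneg.mpr (D.min x))) (by positivity)

/-- The mean of the Lyapunov function after a stochastic gradient step. -/
lemma lintegral_step_le (D : DescentData f xs e η δ ρ L) {Ξ : Type*} [MeasurableSpace Ξ]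
    {ν : Measure Ξ} [IsProbabilityMeasure ν] {g : Euc d → Ξ → Euc d}
    (hg : IsStrongGrowthOracle f ν g ρ) {lam : ℝ} (hlam : 0 ≤ lam) (y Z : Euc d) :
    0 ≤ (1 + lam * e) * (f y - f xs) - lam * e * (‖∇ f y‖ ^ 2 / (2 * ρ * L)) +
          δ / 2 * ‖Z - xs‖ ^ 2 - η * inner ℝ (∇ f y) (Z - xs) ∧
    ∫⁻ s, ENNReal.ofReal (lyapunov f xs (1 + lam * e) δ (y - (1 / (ρ * L)) • g y s)
        (Z - (η / δ) • g y s)) ∂ν ≤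
      ENNReal.ofReal ((1 + lam * e) * (f y - f xs) - lam * e * (‖∇ f y‖ ^ 2 / (2 * ρ * L)) +
          δ / 2 * ‖Z - xs‖ ^ 2 - η * inner ℝ (∇ f y) (Z - xs)) := by
  have hδ := D.delta_pos
  have hL := D.L_pos
  have hρ : 0 < ρ := by linarith [D.one_le_rho]
  have he := D.e_pos
  have hη : 0 < η := D.e_pos.trans_le D.e_le
  set θ := 1 + lam * e with hθ
  have hθpos : 0 ≤ θ := by positivity
  set G := ∇ f y with hG
  set v : Euc d := (-(θ / (ρ * L))) • G - η • (Z - xs) with hv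
  set c := θ * L / 2 * (1 / (ρ * L)) ^ 2 + δ / 2 * (η / δ) ^ 2 with hc
  have hcnn : 0 ≤ c := by positivity
  set A₀ := θ * (f y - f xs) + δ / 2 * ‖Z - xs‖ ^ 2 with hA₀
  have hvw : ∀ w, inner ℝ v w = -(θ / (ρ * L)) * inner ℝ G w - η * inner ℝ (Z - xs) w := fun w => by
    rw [hv, inner_sub_left, inner_smul_left, inner_smul_left]
    simp only [conj_trivial]
  have hpt : ∀ s, lyapunov f xs θ δ (y - (1 / (ρ * L)) • g y s) (Z - (η / δ) • g y s) ≤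
      A₀ + inner ℝ v (g y s) + c * ‖g y s‖ ^ 2 := by
    intro s
    set w := g y s
    have h1 := D.smooth (y - (1 / (ρ * L)) • w) y
    have h2 : y - (1 / (ρ * L)) • w - y = -((1 / (ρ * L)) • w) := by abel
    rw [h2, norm_neg, norm_smul, inner_neg_right, inner_smul_right, mul_pow, Real.norm_eq_abs,
      sq_abs] at h1
    have h3 : Z - (η / δ) • w - xs = (Z - xs) - (η / δ) • w := by abel
    have h4 := norm_sub_sq_real (Z - xs) ((η / δ) • w)
    rw [norm_smul, inner_smul_right, mul_pow, Real.norm_eq_abs, sq_abs] at h4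
    have h5 := mul_le_mul_of_nonneg_left h1 hθpos
    have h6 : δ / 2 * (2 * (η / δ * inner ℝ (Z - xs) w)) = η * inner ℝ (Z - xs) w := by
      field_simp
    rw [lyapunov, h3, h4, hvw]
    have h7 : θ * (1 / (ρ * L) * inner ℝ G w) = θ / (ρ * L) * inner ℝ G w := by ring
    rw [hA₀, hc]
    rw [← hG] at h5
    linarith
  have hgL := hg.memLp y
  have hgint : Integrable (g y) ν := hgL.integrable (by norm_num)
  have hgsq : Integrable (fun s => ‖g y s‖ ^ 2) ν := hgL.integrable_norm_pow (by norm_num)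
  have hinner : Integrable (fun s => inner ℝ v (g y s)) ν := hgint.const_inner v
  have hAi : Integrable (fun s => A₀ + inner ℝ v (g y s)) ν := (integrable_const A₀).add hinner
  have hsum : Integrable (fun s => A₀ + inner ℝ v (g y s) + c * ‖g y s‖ ^ 2) ν :=
    hAi.add (hgsq.const_mul c)
  have hnn : ∀ s, 0 ≤ A₀ + inner ℝ v (g y s) + c * ‖g y s‖ ^ 2 := fun s =>
    (D.lyapunov_nonneg hθpos _ _).trans (hpt s)
  have hval : ∫ s, (A₀ + inner ℝ v (g y s) + c * ‖g y s‖ ^ 2) ∂ν ≤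
      θ * (f y - f xs) - lam * e * (‖G‖ ^ 2 / (2 * ρ * L)) +
          δ / 2 * ‖Z - xs‖ ^ 2 - η * inner ℝ G (Z - xs) := by
    have h1 : ∫ s, (A₀ + inner ℝ v (g y s) + c * ‖g y s‖ ^ 2) ∂ν =
        A₀ + inner ℝ v G + c * ∫ s, ‖g y s‖ ^ 2 ∂ν := by
      rw [integral_add hAi (hgsq.const_mul c),
        integral_add (integrable_const A₀) hinner, integral_const_mul, integral_inner hgint,
        hg.unbiased y]
      simp [hG]
    have h2 := mul_le_mul_of_nonneg_left (hg.growth y) hcnn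
    rw [← hG] at h2
    have h3 : inner ℝ v G = -(θ / (ρ * L)) * ‖G‖ ^ 2 - η * inner ℝ G (Z - xs) := by
      rw [hvw, real_inner_self_eq_norm_sq, real_inner_comm G (Z - xs)]
    -- In units of `‖∇f‖²/(2ρL)` the noise costs `θ` through `x` and `1` through `z`, by the choice
    -- of `δ`. The linear term gains `2θ`, so the net is `1 - θ = -lam e`.
    have h4 : c * (ρ * ‖G‖ ^ 2) = (θ + 1) * (‖G‖ ^ 2 / (2 * ρ * L)) := by
      have : δ / 2 * (η / δ) ^ 2 = 1 / (2 * ρ ^ 2 * L) := by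
        rw [D.delta_eq]
        field_simp
      rw [hc, this]
      field_simp
    have h5 : θ / (ρ * L) * ‖G‖ ^ 2 = 2 * θ * (‖G‖ ^ 2 / (2 * ρ * L)) := by field_simp
    have h6 : lam * e = θ - 1 := by rw [hθ]; ring
    rw [h1, h3, h6, hA₀]
    linarith
  refine ⟨(integral_nonneg hnn).trans hval, ?_⟩
  calc _ ≤ ∫⁻ s, ENNReal.ofReal (A₀ + inner ℝ v (g y s) + c * ‖g y s‖ ^ 2) ∂ν :=
        lintegral_mono fun s => ENNReal.ofReal_le_ofReal (hpt s)
    _ = ENNReal.ofReal (∫ s, (A₀ + inner ℝ v (g y s) + c * ‖g y s‖ ^ 2) ∂ν) :=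
        (ofReal_integral_eq_lintegral_ofReal hsum (ae_of_all _ hnn)).symm
    _ ≤ _ := ENNReal.ofReal_le_ofReal hval

/-- Young's inequality for the change of `f` along the flow, weighted against the gradient. -/
lemma young_le (D : DescentData f xs e η δ ρ L) {k A B G W : ℝ} (hA : 0 ≤ A)
    (hB : 0 ≤ B) (hAB : k ^ 2 ≤ A * B) :
    k * η * (G * W) ≤ B * (G ^ 2 / (2 * ρ * L)) + A * (δ / 2 * W ^ 2) := by
  have hL := D.L_pos
  have hρ : 0 < ρ := by linarith [D.one_le_rho]
  have hη : 0 < η := D.e_pos.trans_le D.e_le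
  set p := B * (G ^ 2 / (2 * ρ * L)) with hp
  set q := A * (δ / 2 * W ^ 2) with hq
  have hp0 : 0 ≤ p := by positivity
  have hq0 : 0 ≤ q := by have := D.delta_pos; positivity
  have hpq : 4 * (p * q) = A * B * ρ * (η * G * W) ^ 2 := by
    rw [hp, hq, D.delta_eq]
    field_simp
    ring
  have h1 : (k * η * (G * W)) ^ 2 ≤ (p + q) ^ 2 := by
    have h2 : k ^ 2 ≤ A * B * ρ := by nlinarith [D.one_le_rho, mul_nonneg hA hB]
    calc (k * η * (G * W)) ^ 2 = k ^ 2 * (η * G * W) ^ 2 := by ring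
      _ ≤ A * B * ρ * (η * G * W) ^ 2 := by gcongr
      _ = 4 * (p * q) := hpq.symm
      _ ≤ (p + q) ^ 2 := by nlinarith [sq_nonneg (p - q)]
  exact abs_le_of_sq_le_sq' h1 (by positivity) |>.2

end DescentData

/-- The flow moves `z` towards `x` by this fraction of `z - x`; `β` expresses the same move relative
to `y`, whose distance to `z` has shrunk by `1 - α`. -/
lemma continuizedBeta_mul {η e : ℝ} (hη : 0 < η) (he : 0 < e) (s : ℝ) :
    continuizedBeta η e s * (1 - continuizedAlpha η e s) =
      e / (η + e) * (1 - Real.exp (-(η + e) * s)) := by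
  have hE := Real.exp_pos (-(η + e) * s)
  rw [continuizedBeta, continuizedAlpha]
  field_simp
  ring

lemma one_sub_continuizedAlpha {η e : ℝ} (hη : 0 < η) (he : 0 < e) (s : ℝ) :
    1 - continuizedAlpha η e s = (e + η * Real.exp (-(η + e) * s)) / (η + e) := by
  rw [continuizedAlpha]
  field_simp
  ring

lemma norm_sub_smul_sq {E : Type*} [NormedAddCommGroup E] [InnerProductSpace ℝ E] (v w : E)
    (t : ℝ) : ‖v - t • w‖ ^ 2 = ‖v‖ ^ 2 - 2 * t * inner ℝ v w + t ^ 2 * ‖w‖ ^ 2 := by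
  rw [norm_sub_sq_real, norm_smul, inner_smul_right, mul_pow, Real.norm_eq_abs, sq_abs]
  ring

/-- The quadratic form in `(z - x*, z - x)` left over by the Lyapunov analysis is dominated. -/
lemma LyapunovWeights.quadratic_le {e lam k A B η : ℝ} (hW : LyapunovWeights e lam k A B)
    (he : 0 < e) (hη : e ≤ η) {E : Type*} [NormedAddCommGroup E] [InnerProductSpace ℝ E]
    (v w : E) :
    (1 - e) * ‖v‖ ^ 2 + 2 * e ^ 2 / (1 + (η + e)) * inner ℝ v w -
      e * ((1 - A) * (1 + (η + e)) + 2 * e ^ 2) / ((1 + (η + e)) * (2 * (1 + (η + e)) - 1)) *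
        ‖w‖ ^ 2 ≤ Real.exp (-e) * ‖v‖ ^ 2 := by
  set s := 1 + (η + e) with hs
  have hs1 : 1 + 2 * e ≤ s := by linarith
  have hdist := hW.dist s hs1
  set P := Real.exp (-e) - 1 + e with hP
  have hspos : 0 < s := by linarith
  have hs2 : 0 < 2 * s - 1 := by linarith
  set K := s * ((1 - A) * s + 2 * e ^ 2) with hK
  have hexp : 0 < P := by
    have := Real.add_one_lt_exp (x := -e) (by linarith)
    linarith
  have hcs := real_inner_le_norm v w
  have hKpos : 0 < K := by
    by_contra hneg
    have h1 : P * K ≤ 0 := mul_nonpos_of_nonneg_of_nonpos hexp.le (not_lt.mp hneg)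
    have h2 : 0 < e ^ 3 * (2 * s - 1) := by positivity
    linarith
  have hq : e * ((1 - A) * s + 2 * e ^ 2) / (s * (2 * s - 1)) = e * K / (s ^ 2 * (2 * s - 1)) := by
    rw [hK]
    field_simp
  rw [hq]
  have hmain : 2 * e ^ 2 / s * (‖v‖ * ‖w‖) ≤ P * ‖v‖ ^ 2 + e * K / (s ^ 2 * (2 * s - 1)) * ‖w‖ ^ 2 := by
    set p := P * ‖v‖ ^ 2
    set q := e * K / (s ^ 2 * (2 * s - 1)) * ‖w‖ ^ 2 with hqdef
    have hp0 : 0 ≤ p := by positivity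
    have hq0 : 0 ≤ q := by positivity
    -- The discriminant condition: after clearing denominators it is `hdist` times `e * s ^ 2`.
    have hpq : (e ^ 2 / s * (‖v‖ * ‖w‖)) ^ 2 ≤ p * q := by
      have h1 : e ^ 4 / s ^ 2 ≤ P * (e * K / (s ^ 2 * (2 * s - 1))) := by
        rw [mul_div_assoc', div_le_div_iff₀ (by positivity) (by positivity)]
        have := mul_le_mul_of_nonneg_left hdist (by positivity : 0 ≤ e * s ^ 2)
        linarith
      calc (e ^ 2 / s * (‖v‖ * ‖w‖)) ^ 2 = e ^ 4 / s ^ 2 * (‖v‖ ^ 2 * ‖w‖ ^ 2) := by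
            field_simp
        _ ≤ P * (e * K / (s ^ 2 * (2 * s - 1))) * (‖v‖ ^ 2 * ‖w‖ ^ 2) := by gcongr
        _ = p * q := by ring
    have h2 : (2 * (e ^ 2 / s * (‖v‖ * ‖w‖))) ^ 2 ≤ (p + q) ^ 2 := by
      nlinarith [sq_nonneg (p - q)]
    have h3 := abs_le_of_sq_le_sq' h2 (by positivity) |>.2
    calc _ = 2 * (e ^ 2 / s * (‖v‖ * ‖w‖)) := by ring
      _ ≤ _ := h3
  have h4 : 2 * e ^ 2 / s * inner ℝ v w ≤ 2 * e ^ 2 / s * (‖v‖ * ‖w‖) := by gcongr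
  have h5 : Real.exp (-e) = P + 1 - e := by rw [hP]; ring
  rw [h5]
  linarith

namespace DescentData

variable {d : ℕ} {f : Euc d → ℝ} {xs : Euc d} {e η δ ρ L : ℝ}

open Filter Topology in
/-- One step of the continuized method contracts the mean of the Lyapunov function by `exp (-e)`. -/
lemma lintegral_run_step_le (D : DescentData f xs e η δ ρ L) {Ξ : Type*} [MeasurableSpace Ξ]
    {ν : Measure Ξ} [IsProbabilityMeasure ν] {g : Euc d → Ξ → Euc d}
    (hg : IsStrongGrowthOracle f ν g ρ) {lam k A B : ℝ} (hW : LyapunovWeights e lam k A B)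
    (x z : Euc d) :
    ∫⁻ s, ∫⁻ c, ENNReal.ofReal (lyapunov f xs (1 + lam * e) δ
        (x + continuizedAlpha η e s • (z - x) -
          (1 / (ρ * L)) • g (x + continuizedAlpha η e s • (z - x)) c)
        (z + continuizedBeta η e s • (x + continuizedAlpha η e s • (z - x) - z) -
          (η / δ) • g (x + continuizedAlpha η e s • (z - x)) c)) ∂ν ∂(expMeasure 1) ≤
      ENNReal.ofReal (Real.exp (-e) * lyapunov f xs (1 + lam * e) δ x z) := by
  have hδ := D.delta_pos
  have he := D.e_pos
  have hη : 0 < η := D.e_pos.trans_le D.e_le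
  set σ := η + e with hσ
  have hσpos : 0 < σ := by positivity
  set w := z - x with hw
  set ζ := z - xs with hζ
  set E : ℝ → ℝ := fun s => Real.exp (-σ * s) with hE
  set Y : ℝ → Euc d := fun s => x + continuizedAlpha η e s • w with hY
  set Z : ℝ → Euc d := fun s => z + continuizedBeta η e s • (Y s - z) with hZ
  have hEder : ∀ s, HasDerivAt E (-σ * E s) s := fun s => by
    have := ((hasDerivAt_id s).const_mul (-σ)).exp
    simpa [hE, mul_comm] using this
  have hYxs : ∀ s, Y s - xs = ζ - ((e + η * E s) / σ) • w := fun s => by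
    have h1 := one_sub_continuizedAlpha hη he s
    have h2 : continuizedAlpha η e s = 1 - (e + η * E s) / σ := by
      rw [← h1]; ring
    simp only [hY, h2, hζ, hw]
    module
  have hZxs : ∀ s, Z s - xs = ζ - (e / σ * (1 - E s)) • w := fun s => by
    have h1 : Y s - z = -((1 - continuizedAlpha η e s) • w) := by
      simp only [hY, hw]
      module
    simp only [hZ, h1]
    rw [smul_neg, smul_smul, continuizedBeta_mul hη he s, hζ]
    simp only [hE]
    module
  have hYder : ∀ s, HasDerivAt Y ((η * E s) • w) s := fun s => by
    have h1 : HasDerivAt (fun s => continuizedAlpha η e s) (η * E s) s := by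
      have := ((hEder s).const_sub 1).const_mul (η / (η + e))
      refine this.congr_deriv ?_
      rw [← hσ]
      field_simp
    exact (h1.smul_const w).const_add x
  have hφder : ∀ s, HasDerivAt (fun s => f (Y s) - f xs)
      (η * E s * inner ℝ (∇ f (Y s)) w) s := fun s => by
    have h1 := (D.differentiable (Y s)).hasGradientAt.hasFDerivAt.comp_hasDerivAt s (hYder s)
    have h2 : HasDerivAt (fun s => f (Y s)) (inner ℝ (∇ f (Y s)) ((η * E s) • w)) s := h1
    rw [inner_smul_right] at h2
    exact h2.sub_const (f xs)
  set V := ‖ζ‖ ^ 2 with hV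
  set I : ℝ := inner ℝ ζ w with hI
  set U := ‖w‖ ^ 2 with hU
  -- Coefficients in powers of `E` of `‖Z - x*‖² - e‖Y - x*‖² + eA E²‖w‖²`, as checked in `hpoly`.
  set p₀ := (1 - e) * V + 2 * e / σ * (e - 1) * I + U * (e ^ 2 / σ ^ 2 - e * (e ^ 2 / σ ^ 2)) with hp₀
  set p₁ := 2 * e / σ * (1 + η) * I + U * (-2 * e ^ 2 / σ ^ 2 - 2 * e * (e * η / σ ^ 2)) with hp₁
  set p₂ := U * (e ^ 2 / σ ^ 2 - e * (η ^ 2 / σ ^ 2) + e * A) with hp₂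
  -- As `E' = -σE`, dividing the coefficient of `E^j` by `1 + jσ` solves `h - h' = p₀ + p₁E + p₂E²`.
  set H : ℝ → ℝ := fun s => (1 - k * e) * (f (Y s) - f xs) +
    δ / 2 * (p₀ + p₁ / (1 + σ) * E s + p₂ / (1 + 2 * σ) * E s ^ 2) with hH
  set H' : ℝ → ℝ := fun s => (1 - k * e) * (η * E s * inner ℝ (∇ f (Y s)) w) +
    δ / 2 * (p₁ / (1 + σ) * (-σ * E s) + p₂ / (1 + 2 * σ) * (2 * E s * (-σ * E s))) with hH'
  set J : ℝ → ℝ := fun s => (1 + lam * e) * (f (Y s) - f xs) -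
    lam * e * (‖∇ f (Y s)‖ ^ 2 / (2 * ρ * L)) +
    δ / 2 * ‖Z s - xs‖ ^ 2 - η * inner ℝ (∇ f (Y s)) (Z s - xs) with hJ
  have hHder : ∀ s, HasDerivAt H (H' s) s := fun s => by
    have h1 := (hEder s).const_mul (p₁ / (1 + σ))
    have h2 := ((hEder s).pow 2).const_mul (p₂ / (1 + 2 * σ))
    have h3 := ((h1.const_add p₀).add h2).const_mul (δ / 2)
    refine (((hφder s).const_mul (1 - k * e)).add h3).congr_deriv ?_
    simp [hH']
  have hElim : Tendsto E atTop (𝓝 0) := by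
    have : Tendsto (fun s => -σ * s) atTop atBot :=
      tendsto_id.const_mul_atTop_of_neg (by linarith)
    exact Real.tendsto_exp_atBot.comp this
  have hlim : Tendsto (fun s => Real.exp (-s) * H s) atTop (𝓝 0) := by
    have h1 : Tendsto (fun s : ℝ => Real.exp (-s)) atTop (𝓝 0) :=
      Real.tendsto_exp_neg_atTop_nhds_zero
    have hYlim : Tendsto Y atTop (𝓝 (x + (η / (η + e) * (1 - 0)) • w)) :=
      (((hElim.const_sub 1).const_mul (η / (η + e))).smul_const w).const_add x
    have h2 := ((D.contDiff.continuous.tendsto _).comp hYlim).sub_const (f xs)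
    have h3 := ((((hElim.const_mul (p₁ / (1 + σ))).const_add p₀).add
      ((hElim.pow 2).const_mul (p₂ / (1 + 2 * σ)))).const_mul (δ / 2))
    have h4 := h1.mul ((h2.const_mul (1 - k * e)).add h3)
    rw [zero_mul] at h4
    exact h4
  have hsub : ∀ s, H s - H' s = (1 - k * e) * ((f (Y s) - f xs) -
      η * E s * inner ℝ (∇ f (Y s)) w) + δ / 2 * (p₀ + p₁ * E s + p₂ * E s ^ 2) := fun s => by
    simp only [hH, hH']
    field_simp
    ring
  have hle : ∀ s, J s ≤ H s - H' s := fun s => by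
    rw [hsub]
    simp only [hJ]
    have hEpos : 0 < E s := Real.exp_pos _
    have haim := D.aim (Y s)
    have hgrad := D.grad (Y s)
    set F := f (Y s) - f xs with hF
    have hF0 : 0 ≤ F := sub_nonneg.mpr (D.min _)
    set G := ∇ f (Y s) with hG
    set Q := ‖G‖ ^ 2 / (2 * ρ * L) with hQ
    have hZY : Z s - xs = (Y s - xs) + E s • w := by
      rw [hYxs, hZxs]
      have : (e + η * E s) / σ = e / σ * (1 - E s) + E s := by
        rw [hσ]
        field_simp
        ring
      rw [this]
      module
    have hinner : inner ℝ G (Z s - xs) = inner ℝ G (Y s - xs) + E s * inner ℝ G w := by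
      rw [hZY, inner_add_right, inner_smul_right]
    rw [hinner]
    have hyoung := D.young_le (G := ‖G‖) (W := E s * ‖w‖) hW.A_nonneg hW.B_nonneg hW.young
    have hcs : -(‖G‖ * ‖w‖) ≤ inner ℝ G w := (abs_le.mp (abs_real_inner_le_norm G w)).1
    have hcs' := mul_le_mul_of_nonneg_left hcs
      (mul_nonneg (mul_nonneg hW.k_nonneg hη.le) hEpos.le)
    -- What remains after aiming and Young: the surplus of `F` is paid by the gradient, through `e²F
    -- ≤ Q`.
    have hweights : (lam - 1 + k) * F ≤ (lam - B) * Q := by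
      have h1 : 0 ≤ lam - B := by
        have h2 := hW.descent
        have h3 := hW.excess_nonneg
        by_contra hneg
        have : (lam - B) * e ^ 2 < 0 := mul_neg_of_neg_of_pos (not_le.mp hneg) (by positivity)
        linarith
      have h2 : lam - 1 + k ≤ (lam - B) * e ^ 2 := by linarith [hW.descent]
      calc (lam - 1 + k) * F ≤ (lam - B) * e ^ 2 * F := by gcongr
        _ = (lam - B) * (e ^ 2 * F) := by ring
        _ ≤ (lam - B) * Q := by gcongr
    have hweights' := mul_le_mul_of_nonneg_left hweights he.le
    have hyoung' := mul_le_mul_of_nonneg_left hyoung he.le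
    have hcs'' := mul_le_mul_of_nonneg_left hcs' he.le
    have hpoly : p₀ + p₁ * E s + p₂ * E s ^ 2 =
        ‖Z s - xs‖ ^ 2 - e * ‖Y s - xs‖ ^ 2 + e * A * (E s ^ 2 * U) := by
      rw [hYxs, hZxs, norm_sub_smul_sq, norm_sub_smul_sq, hp₀, hp₁, hp₂]
      field_simp
      ring
    rw [hpoly]
    rw [mul_pow] at hyoung'
    linarith
  have hnn : ∀ s, 0 ≤ H s - H' s := fun s =>
    (D.lintegral_step_le hg hW.lam_nonneg (Y s) (Z s)).1.trans (hle s)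
  have hH0 : H 0 ≤ Real.exp (-e) * lyapunov f xs (1 + lam * e) δ x z := by
    have hE0 : E 0 = 1 := by simp [hE]
    have hY0 : Y 0 = x := by simp [hY, continuizedAlpha]
    have hF0 : 0 ≤ f x - f xs := sub_nonneg.mpr (D.min _)
    have hquad := hW.quadratic_le he D.e_le ζ w
    have hpoly : p₀ + p₁ / (1 + σ) * 1 + p₂ / (1 + 2 * σ) * 1 ^ 2 =
        (1 - e) * V + 2 * e ^ 2 / (1 + (η + e)) * I -
          e * ((1 - A) * (1 + (η + e)) + 2 * e ^ 2) /
            ((1 + (η + e)) * (2 * (1 + (η + e)) - 1)) * U := by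
      have h1 : 2 * (1 + (η + e)) - 1 = 1 + 2 * (η + e) := by ring
      rw [hp₀, hp₁, hp₂, hσ, h1]
      field_simp
      ring
    simp only [hH, hE0, hY0, lyapunov, hpoly]
    have h1 := mul_le_mul_of_nonneg_right hW.value hF0
    have h2 := mul_le_mul_of_nonneg_left hquad (by positivity : 0 ≤ δ / 2)
    linarith
  calc _ ≤ ∫⁻ s, ENNReal.ofReal (J s) ∂(expMeasure 1) :=
        lintegral_mono fun s => (D.lintegral_step_le hg hW.lam_nonneg (Y s) (Z s)).2
    _ ≤ ENNReal.ofReal (H 0) := lintegral_expMeasure_le hHder hlim hnn hle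
    _ ≤ _ := ENNReal.ofReal_le_ofReal hH0

end DescentData

/-! ### Iteration with independent noise, and Markov's inequality -/

/-- One step of the continuized Nesterov method, as a function of the state `(x, z)` and of the
waiting time and mark. -/
noncomputable def nesterovStep {d : ℕ} {Ξ : Type*} (g : Euc d → Ξ → Euc d) (η η' γ γ' : ℝ)
    (q : (Euc d × Euc d) × (ℝ × Ξ)) : Euc d × Euc d :=
  let y := q.1.1 + continuizedAlpha η η' q.2.1 • (q.1.2 - q.1.1)
  (y - γ • g y q.2.2, q.1.2 + continuizedBeta η η' q.2.1 • (y - q.1.2) - γ' • g y q.2.2)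

lemma measurable_nesterovStep {d : ℕ} {Ξ : Type*} [MeasurableSpace Ξ] {g : Euc d → Ξ → Euc d}
    (hg : Measurable fun p : Euc d × Ξ => g p.1 p.2) (η η' γ γ' : ℝ) :
    Measurable (nesterovStep g η η' γ γ') := by
  have hα : Measurable (continuizedAlpha η η') := by
    unfold continuizedAlpha
    fun_prop
  have hβ : Measurable (continuizedBeta η η') := by
    unfold continuizedBeta
    fun_prop
  have hy : Measurable fun q : (Euc d × Euc d) × (ℝ × Ξ) =>
      q.1.1 + continuizedAlpha η η' q.2.1 • (q.1.2 - q.1.1) := by fun_prop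
  have hgy : Measurable fun q : (Euc d × Euc d) × (ℝ × Ξ) =>
      g (q.1.1 + continuizedAlpha η η' q.2.1 • (q.1.2 - q.1.1)) q.2.2 :=
    hg.comp (hy.prodMk measurable_snd.snd)
  unfold nesterovStep
  fun_prop

section Recursion

variable {Ω α β : Type*} [mα : MeasurableSpace α] [mβ : MeasurableSpace β]

/-- A state driven by a recursion is measurable with respect to the past of the driving noise. -/
lemma measurable_past_of_recursion {S : ℕ → Ω → α} {p : ℕ → Ω → β} {Φ : α × β → α}
    (hΦ : Measurable Φ) {s₀ : α} (h0 : ∀ ω, S 0 ω = s₀)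
    (hrec : ∀ k ω, S (k + 1) ω = Φ (S k ω, p k ω)) (k : ℕ) :
    Measurable[⨆ i ∈ Set.Iio k, MeasurableSpace.comap (p i) mβ] (S k) := by
  induction k with
  | zero =>
    rw [show S 0 = fun _ => s₀ from funext h0]
    exact measurable_const
  | succ k ih =>
    rw [show S (k + 1) = fun ω => Φ (S k ω, p k ω) from funext (hrec k)]
    have h1 : Measurable[⨆ i ∈ Set.Iio (k + 1), MeasurableSpace.comap (p i) mβ] (S k) :=
      ih.mono (biSup_mono fun i hi => Set.Iio_subset_Iio (Nat.le_succ k) hi) le_rfl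
    have h2 : Measurable[⨆ i ∈ Set.Iio (k + 1), MeasurableSpace.comap (p i) mβ] (p k) :=
      (comap_measurable (p k)).mono
        (le_biSup (fun i => MeasurableSpace.comap (p i) mβ) (Set.mem_Iio.mpr k.lt_succ_self)) le_rfl
    exact hΦ.comp (h1.prodMk h2)

variable [MeasurableSpace Ω] {P : Measure Ω}

lemma measurable_of_recursion {S : ℕ → Ω → α} {p : ℕ → Ω → β} {Φ : α × β → α}
    (hΦ : Measurable Φ) (hp : ∀ k, Measurable (p k)) {s₀ : α} (h0 : ∀ ω, S 0 ω = s₀)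
    (hrec : ∀ k ω, S (k + 1) ω = Φ (S k ω, p k ω)) (k : ℕ) : Measurable (S k) :=
  (measurable_past_of_recursion hΦ h0 hrec k).mono (iSup₂_le fun i _ => (hp i).comap_le) le_rfl

/-- A state driven by a recursion is independent of the current noise. -/
lemma indepFun_of_recursion {S : ℕ → Ω → α} {p : ℕ → Ω → β} {Φ : α × β → α}
    (hΦ : Measurable Φ) (hp : ∀ k, Measurable (p k)) (hind : iIndepFun p P)
    {s₀ : α} (h0 : ∀ ω, S 0 ω = s₀)
    (hrec : ∀ k ω, S (k + 1) ω = Φ (S k ω, p k ω)) (k : ℕ) : IndepFun (S k) (p k) P := by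
  have hdisj : Disjoint (Set.Iio k) {k} := by simp
  have h1 := indep_iSup_of_disjoint (m := fun i => MeasurableSpace.comap (p i) mβ)
    (fun i => (hp i).comap_le) hind.iIndep hdisj
  rw [IndepFun_iff_Indep]
  refine indep_of_indep_of_le_left (indep_of_indep_of_le_right h1 ?_)
    (measurable_past_of_recursion hΦ h0 hrec k).comap_le
  simp

/-- A nonnegative function of a state driven by independent noise decays geometrically in mean as
soon as it contracts in mean at each step. -/
lemma lintegral_recursion_le [IsProbabilityMeasure P] {S : ℕ → Ω → α} {p : ℕ → Ω → β}
    {Φ : α × β → α} (hΦ : Measurable Φ) (hp : ∀ k, Measurable (p k)) (hind : iIndepFun p P)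
    {κ : Measure β} [SFinite κ] (hlaw : ∀ k, P.map (p k) = κ)
    {s₀ : α} (h0 : ∀ ω, S 0 ω = s₀)
    (hrec : ∀ k ω, S (k + 1) ω = Φ (S k ω, p k ω)) {V : α → ENNReal} (hV : Measurable V)
    {r : ENNReal} (hstep : ∀ s, ∫⁻ b, V (Φ (s, b)) ∂κ ≤ r * V s) (k : ℕ) :
    ∫⁻ ω, V (S k ω) ∂P ≤ r ^ k * V s₀ := by
  induction k with
  | zero => simp [h0]
  | succ k ih =>
    have hS := measurable_of_recursion hΦ hp h0 hrec k
    have hmap := (indepFun_iff_map_prod_eq_prod_map_map hS.aemeasurable (hp k).aemeasurable).mp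
      (indepFun_of_recursion hΦ hp hind h0 hrec k)
    rw [hlaw k] at hmap
    calc ∫⁻ ω, V (S (k + 1) ω) ∂P = ∫⁻ ω, V (Φ (S k ω, p k ω)) ∂P := by simp_rw [hrec]
      _ = ∫⁻ q, V (Φ q) ∂(P.map fun ω => (S k ω, p k ω)) :=
          (lintegral_map (hV.comp hΦ) (hS.prodMk (hp k))).symm
      _ = ∫⁻ s, ∫⁻ b, V (Φ (s, b)) ∂κ ∂(P.map (S k)) := by
          rw [hmap, lintegral_prod (fun q => V (Φ q)) (hV.comp hΦ).aemeasurable]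
      _ ≤ ∫⁻ s, r * V s ∂(P.map (S k)) := lintegral_mono hstep
      _ = r * ∫⁻ ω, V (S k ω) ∂P := by
          rw [lintegral_const_mul _ hV, lintegral_map hV hS]
      _ ≤ r * (r ^ k * V s₀) := by gcongr
      _ = r ^ (k + 1) * V s₀ := by ring

end Recursion

/-- Markov's inequality, for an upper bound `m` of the mean that may vanish. -/
lemma one_sub_inv_le_measureReal {Ω : Type*} [MeasurableSpace Ω] {P : Measure Ω}
    [IsProbabilityMeasure P] {X : Ω → ℝ} (hX : Measurable X) {m c : ℝ}
    (hm : 0 ≤ m) (hc : 0 < c) (hmean : ∫⁻ ω, ENNReal.ofReal (X ω) ∂P ≤ ENNReal.ofReal m) :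
    1 - 1 / c ≤ P.real {ω | X ω ≤ c * m} := by
  have hmeas : MeasurableSet {ω | X ω ≤ c * m} := measurableSet_le hX measurable_const
  have hcompl : P.real {ω | X ω ≤ c * m}ᶜ ≤ 1 / c := by
    -- For `m = 0` one cannot divide by `m`; a vanishing mean forces `X ≤ 0` almost everywhere.
    rcases hm.eq_or_lt with rfl | hmpos
    · have hae : ∀ᵐ ω ∂P, ENNReal.ofReal (X ω) = 0 := by
        have : ∫⁻ ω, ENNReal.ofReal (X ω) ∂P = 0 := by simpa using hmean
        exact (lintegral_eq_zero_iff hX.ennreal_ofReal).mp this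
      have hz : P {ω | X ω ≤ c * 0}ᶜ = 0 := by
        have hle : ∀ᵐ ω ∂P, X ω ≤ c * 0 := by
          filter_upwards [hae] with ω hω
          simpa using ENNReal.ofReal_eq_zero.mp hω
        exact hle
      rw [measureReal_def, hz]
      simp only [ENNReal.toReal_zero]
      positivity
    · have hsub : {ω | X ω ≤ c * m}ᶜ ⊆ {ω | ENNReal.ofReal (c * m) ≤ ENNReal.ofReal (X ω)} := by
        intro ω hω
        have : c * m < X ω := not_le.mp hω
        exact ENNReal.ofReal_le_ofReal this.le
      have hmk := mul_meas_ge_le_lintegral (μ := P) hX.ennreal_ofReal (ENNReal.ofReal (c * m))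
      have h1 : ENNReal.ofReal (c * m) * P {ω | X ω ≤ c * m}ᶜ ≤ ENNReal.ofReal m :=
        (mul_le_mul_right (measure_mono hsub) _).trans (hmk.trans hmean)
      have h2 := ENNReal.toReal_mono ENNReal.ofReal_ne_top h1
      rw [ENNReal.toReal_mul, ENNReal.toReal_ofReal (by positivity), ENNReal.toReal_ofReal hm,
        ← measureReal_def] at h2
      rw [le_div_iff₀ hc]
      refine le_of_mul_le_mul_right ?_ hmpos
      linarith
  have := probReal_compl_eq_one_sub (μ := P) hmeas
  linarith

lemma IsMarkedExpClock.map_pair {Ω Ξ : Type*} [MeasurableSpace Ω] [MeasurableSpace Ξ]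
    {P : Measure Ω} [IsProbabilityMeasure P] {ν : Measure Ξ} {T : ℕ → Ω → ℝ} {ξ : ℕ → Ω → Ξ}
    (h : IsMarkedExpClock P ν T ξ) (k : ℕ) :
    P.map (fun ω => (T (k + 1) ω - T k ω, ξ k ω)) = (expMeasure 1).prod ν := by
  have hτ : Measurable fun ω => T (k + 1) ω - T k ω :=
    (h.measurable_time (k + 1)).sub (h.measurable_time k)
  rw [(indepFun_iff_map_prod_eq_prod_map_map hτ.aemeasurable
    (h.measurable_mark k).aemeasurable).mp (h.indep_entries k), h.law_time k, h.law_mark k]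

/-- Exact gradients are a stochastic oracle with trivial noise. -/
lemma IsStrongGrowthOracle.of_gradient {d : ℕ} {f : Euc d → ℝ} (hf : ContDiff ℝ 1 f)
    (ν : Measure Unit) [IsProbabilityMeasure ν] :
    IsStrongGrowthOracle f ν (fun x _ => ∇ f x) 1 where
  measurable := by
    have : Continuous fun x => ∇ f x :=
      (InnerProductSpace.toDual ℝ (Euc d)).symm.continuous.comp (hf.continuous_fderiv one_ne_zero)
    exact this.measurable.comp measurable_fst
  memLp x := memLp_const _
  unbiased x := by simp
  growth x := by simp

/-- Trivial marks make the exact-gradient method the stochastic one with `ρ = 1`. -/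
lemma IsExpClock.isMarkedExpClock {Ω : Type*} [MeasurableSpace Ω] {P : Measure Ω}
    [IsProbabilityMeasure P] {T : ℕ → Ω → ℝ} (h : IsExpClock P T) :
    IsMarkedExpClock P (Measure.dirac ()) T (fun _ _ => ()) where
  measurable_time := h.measurable
  measurable_mark _ := measurable_const
  law_time := h.law
  law_mark _ := by simp [Measure.map_const]
  indep_entries _ := indepFun_const_right _ _
  indep_pairs := h.indep.comp (fun _ t => (t, ())) fun _ => measurable_id.prodMk measurable_const

namespace DescentData

variable {d : ℕ} {f : Euc d → ℝ} {xs : Euc d} {e η δ ρ L : ℝ}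

/-- Geometric decay in mean of the continuized Nesterov method. -/
lemma lintegral_run_le (D : DescentData f xs e η δ ρ L) {Ω Ξ : Type*} [MeasurableSpace Ω]
    [MeasurableSpace Ξ] {P : Measure Ω} [IsProbabilityMeasure P] {ν : Measure Ξ}
    [IsProbabilityMeasure ν] {T : ℕ → Ω → ℝ} {ξ : ℕ → Ω → Ξ} (hT : IsMarkedExpClock P ν T ξ)
    {g : Euc d → Ξ → Euc d} (hg : IsStrongGrowthOracle f ν g ρ) {x₀ : Euc d}
    {x y z : ℕ → Ω → Euc d} (h0 : ∀ ω, x 0 ω = x₀ ∧ z 0 ω = x₀)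
    (hrun : ∀ ω, IsNesterovRun (fun k v => g v (ξ k ω))
      (fun k => continuizedAlpha η e (T (k + 1) ω - T k ω))
      (fun k => continuizedBeta η e (T (k + 1) ω - T k ω)) (1 / (ρ * L)) (η / δ)
      (fun k => x k ω) (fun k => y k ω) (fun k => z k ω)) (k : ℕ) :
    Measurable (x k) ∧ ∫⁻ ω, ENNReal.ofReal (f (x k ω) - f xs) ∂P ≤
      ENNReal.ofReal (Real.exp (-e * k) * (f x₀ - f xs + δ / 2 * ‖x₀ - xs‖ ^ 2)) := by
  obtain ⟨lam, κ, A, B, hW⟩ := exists_lyapunovWeights D.e_pos D.e_le_one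
  have := isProbabilityMeasure_expMeasure one_pos
  have hδ := D.delta_pos
  have hθ : 1 ≤ 1 + lam * e := le_add_of_nonneg_right (mul_nonneg hW.lam_nonneg D.e_pos.le)
  set θ := 1 + lam * e with hθdef
  have hθ0 : 0 < θ := by linarith
  set p : ℕ → Ω → ℝ × Ξ := fun k ω => (T (k + 1) ω - T k ω, ξ k ω) with hpdef
  have hp : ∀ k, Measurable (p k) := fun k =>
    ((hT.measurable_time (k + 1)).sub (hT.measurable_time k)).prodMk (hT.measurable_mark k)
  set S : ℕ → Ω → Euc d × Euc d := fun k ω => (x k ω, z k ω) with hSdef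
  have hΦ := measurable_nesterovStep hg.measurable η e (1 / (ρ * L)) (η / δ)
  have hS0 : ∀ ω, S 0 ω = (x₀, x₀) := fun ω => Prod.ext (h0 ω).1 (h0 ω).2
  have hrec : ∀ k ω, S (k + 1) ω = nesterovStep g η e (1 / (ρ * L)) (η / δ) (S k ω, p k ω) := by
    intro k ω
    obtain ⟨hy, hx, hz⟩ := hrun ω k
    simp only at hy hx hz
    simp only [hSdef, nesterovStep, hpdef, ← hy, hx, hz]
  have hV : Measurable fun q : Euc d × Euc d => ENNReal.ofReal (lyapunov f xs θ δ q.1 q.2) := by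
    have := D.contDiff.continuous
    unfold lyapunov
    exact Measurable.ennreal_ofReal (by fun_prop)
  have hxk : Measurable (x k) := (measurable_of_recursion hΦ hp hS0 hrec k).fst
  refine ⟨hxk, ?_⟩
  have hmain := lintegral_recursion_le hΦ hp hT.indep_pairs hT.map_pair hS0 hrec hV
    (r := ENNReal.ofReal (Real.exp (-e))) (fun q => by
      rw [← ENNReal.ofReal_mul (Real.exp_pos _).le]
      refine le_trans (le_of_eq ?_) (D.lintegral_run_step_le hg hW q.1 q.2)
      refine lintegral_prod (fun b => ENNReal.ofReal (lyapunov f xs θ δ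
        (nesterovStep g η e (1 / (ρ * L)) (η / δ) (q, b)).1
        (nesterovStep g η e (1 / (ρ * L)) (η / δ) (q, b)).2)) ?_
      exact (hV.comp (hΦ.comp measurable_prodMk_left)).aemeasurable) k
  rw [← ENNReal.ofReal_pow (Real.exp_pos _).le, ← Real.exp_nat_mul,
    ← ENNReal.ofReal_mul (Real.exp_pos _).le] at hmain
  have hF0 : 0 ≤ f x₀ - f xs := sub_nonneg.mpr (D.min _)
  -- Dividing the energy by `θ ≥ 1` restores weight one on `f` and only shrinks the initial distance
  -- term, so `lam` leaves no trace in the constant.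
  calc ∫⁻ ω, ENNReal.ofReal (f (x k ω) - f xs) ∂P
      ≤ ∫⁻ ω, ENNReal.ofReal θ⁻¹ * ENNReal.ofReal (lyapunov f xs θ δ (x k ω) (z k ω)) ∂P := by
        refine lintegral_mono fun ω => ?_
        rw [← ENNReal.ofReal_mul (by positivity)]
        refine ENNReal.ofReal_le_ofReal ?_
        rw [lyapunov, mul_add, inv_mul_cancel_left₀ hθ0.ne']
        exact le_add_of_nonneg_right (by positivity)
    _ = ENNReal.ofReal θ⁻¹ * ∫⁻ ω, ENNReal.ofReal (lyapunov f xs θ δ (x k ω) (z k ω)) ∂P :=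
        lintegral_const_mul' _ _ ENNReal.ofReal_ne_top
    _ ≤ ENNReal.ofReal θ⁻¹ *
        ENNReal.ofReal (Real.exp (k * -e) * lyapunov f xs θ δ x₀ x₀) := by gcongr
    _ ≤ _ := by
        rw [← ENNReal.ofReal_mul (by positivity)]
        refine ENNReal.ofReal_le_ofReal ?_
        rw [mul_comm (k : ℝ) (-e), mul_left_comm, lyapunov, mul_add, inv_mul_cancel_left₀ hθ0.ne']
        have hle : θ⁻¹ * (δ / 2 * ‖x₀ - xs‖ ^ 2) ≤ δ / 2 * ‖x₀ - xs‖ ^ 2 :=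
          mul_le_of_le_one_left (by positivity) (inv_le_one_of_one_le₀ hθ)
        gcongr

/-- High-probability bound for the continuized Nesterov method, for any rate `r ≤ e`. -/
lemma measureReal_run_ge (D : DescentData f xs e η δ ρ L) {Ω Ξ : Type*} [MeasurableSpace Ω]
    [MeasurableSpace Ξ] {P : Measure Ω} [IsProbabilityMeasure P] {ν : Measure Ξ}
    [IsProbabilityMeasure ν] {T : ℕ → Ω → ℝ} {ξ : ℕ → Ω → Ξ} (hT : IsMarkedExpClock P ν T ξ)
    {g : Euc d → Ξ → Euc d} (hg : IsStrongGrowthOracle f ν g ρ) {x₀ : Euc d}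
    {x y z : ℕ → Ω → Euc d} (h0 : ∀ ω, x 0 ω = x₀ ∧ z 0 ω = x₀)
    (hrun : ∀ ω, IsNesterovRun (fun k v => g v (ξ k ω))
      (fun k => continuizedAlpha η e (T (k + 1) ω - T k ω))
      (fun k => continuizedBeta η e (T (k + 1) ω - T k ω)) (1 / (ρ * L)) (η / δ)
      (fun k => x k ω) (fun k => y k ω) (fun k => z k ω))
    {C : ℝ} (hC : f x₀ - f xs + δ / 2 * ‖x₀ - xs‖ ^ 2 ≤ C * (f x₀ - f xs))
    {c₀ c₁ : ℝ} (hc₀ : 0 < c₀) (hc₁ : 0 ≤ c₁) (k : ℕ) :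
    1 - 1 / c₀ ≤ P.real {ω | f (x k ω) - f xs ≤
      c₀ * C * (f x₀ - f xs) * Real.exp (-e * (1 - c₁) * k)} := by
  obtain ⟨hxk, hmean⟩ := D.lintegral_run_le hT hg h0 hrun k
  have hδ := D.delta_pos
  have hF0 : 0 ≤ f x₀ - f xs := sub_nonneg.mpr (D.min _)
  have hnn : 0 ≤ f x₀ - f xs + δ / 2 * ‖x₀ - xs‖ ^ 2 := by positivity
  have hmeas : Measurable fun ω => f (x k ω) - f xs :=
    (D.contDiff.continuous.measurable.comp hxk).sub_const _
  refine (one_sub_inv_le_measureReal hmeas (by positivity) hc₀ hmean).trans ?_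
  refine measureReal_mono fun ω hω => ?_
  have hω' : f (x k ω) - f xs ≤
      c₀ * (Real.exp (-e * k) * (f x₀ - f xs + δ / 2 * ‖x₀ - xs‖ ^ 2)) := hω
  refine hω'.trans ?_
  -- The mean already decays at the full rate `e`; `c₁ ≥ 0` only weakens the bound.
  have hexp : Real.exp (-e * k) ≤ Real.exp (-e * (1 - c₁) * k) := by
    refine Real.exp_le_exp.mpr ?_
    have := mul_nonneg (mul_nonneg D.e_pos.le hc₁) (Nat.cast_nonneg (α := ℝ) k)
    linarith
  calc c₀ * (Real.exp (-e * k) * (f x₀ - f xs + δ / 2 * ‖x₀ - xs‖ ^ 2))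
      ≤ c₀ * (Real.exp (-e * (1 - c₁) * k) * (C * (f x₀ - f xs))) := by gcongr
    _ = _ := by ring

end DescentData

/-! ### Parameter identities and the theorem -/

section Constants

variable {m M : ℝ}

lemma rpow_quarter_sq {t : ℝ} (ht : 0 ≤ t) : (t ^ (1 / 4 : ℝ)) ^ 2 = √t := by
  rw [← Real.rpow_natCast, ← Real.rpow_mul ht, Real.sqrt_eq_rpow]
  norm_num

lemma rpow_quarter_div_mul_sqrt (hm : 0 < m) (hM : 0 < M) :
    (m / M) ^ (1 / 4 : ℝ) * √M = (m * M) ^ (1 / 4 : ℝ) := by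
  rw [Real.div_rpow hm.le hM.le, Real.mul_rpow hm.le hM.le, Real.sqrt_eq_rpow, div_mul_eq_mul_div,
    mul_div_assoc, ← Real.rpow_sub hM]
  norm_num

lemma sqrt_mul_div_left (hm : 0 < m) : √(m * M) / m = √(M / m) := by
  rw [mul_comm, Real.sqrt_mul' _ hm.le, Real.sqrt_div' _ hm.le, mul_div_assoc, Real.sqrt_div_self,
    div_eq_mul_inv]

end Constants

/-- Lower quadratic growth bounds the initial Lyapunov value. -/
lemma QGLower.lyapunov_init_le {d : ℕ} {f : Euc d → ℝ} {xs : Euc d} {m M : ℝ} (hm : 0 < m)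
    (h : QGLower f xs m) (x : Euc d) :
    f x - f xs + √(m * M) / 2 * ‖x - xs‖ ^ 2 ≤ (1 + √(M / m)) * (f x - f xs) := by
  have h1 := mul_le_mul_of_nonneg_left (h x) (Real.sqrt_nonneg (M / m))
  rw [← sqrt_mul_div_left hm] at h1 ⊢
  have h2 : √(m * M) / m * (m / 2 * ‖x - xs‖ ^ 2) = √(m * M) / 2 * ‖x - xs‖ ^ 2 := by field_simp
  linarith

/-- The parameters of the stochastic method satisfy the hypotheses of the Lyapunov analysis. -/
lemma DescentData.of_growth {d : ℕ} {f : Euc d → ℝ} {xs : Euc d} (hf : ContDiff ℝ 1 f)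
    (hxs : IsUniqueMinimizer f xs) {μ a L μ₀ L₀ ρ : ℝ} (hμ : 0 < μ) (ha : 0 < a) (ha1 : a ≤ 1)
    (hL : 0 < L) (hPL : IsPL f xs μ) (hAC : IsAiming f xs a) (hLS : IsLSmooth f L)
    (hμμ₀ : μ ≤ μ₀) (hμ₀L₀ : μ₀ ≤ L₀) (hL₀L : L₀ ≤ L) (hlo : QGLower f xs μ₀)
    (hup : QGUpper f xs L₀) (hρ : 1 ≤ ρ) :
    DescentData f xs (a / ρ * (μ₀ / L₀) ^ (1 / 4 : ℝ) * √(μ / L))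
      (1 / ρ * ((μ₀ * L₀) ^ (1 / 4 : ℝ) / √L)) √(μ₀ * L₀) ρ L := by
  have hμ₀ : 0 < μ₀ := hμ.trans_le hμμ₀
  have hL₀ : 0 < L₀ := hμ₀.trans_le hμ₀L₀
  have hρ0 : 0 < ρ := by linarith
  set κ := (μ₀ * L₀) ^ (1 / 4 : ℝ) with hκ
  set q := (μ₀ / L₀) ^ (1 / 4 : ℝ) with hq
  have hκpos : 0 < κ := by positivity
  have hqpos : 0 < q := by positivity
  have hκsq : κ ^ 2 = √(μ₀ * L₀) := rpow_quarter_sq (by positivity)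
  have hqκ : q * √L₀ = κ := rpow_quarter_div_mul_sqrt hμ₀ hL₀
  have hsL : 0 < √L := Real.sqrt_pos.mpr hL
  have hsL₀ : 0 < √L₀ := Real.sqrt_pos.mpr hL₀
  have hsμ : 0 < √μ := Real.sqrt_pos.mpr hμ
  -- This reads `η' = η · a√μ/√L₀`, so `aim` is the radial inequality multiplied by `η`.
  have hfac : a / ρ * q * √(μ / L) = 1 / ρ * (κ / √L) * (a * √μ / √L₀) := by
    rw [Real.sqrt_div hμ.le, ← hqκ]
    field_simp
  have hκL : κ ≤ √L := by
    have h1 : κ ^ 2 ≤ √L ^ 2 := by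
      rw [hκsq, Real.sq_sqrt hL.le]
      refine Real.sqrt_le_iff.mpr ⟨hL.le, ?_⟩
      nlinarith
    exact abs_le_of_sq_le_sq' h1 hsL.le |>.2
  have hη1 : 1 / ρ * (κ / √L) ≤ 1 :=
    mul_le_one₀ (by rw [div_le_one hρ0]; exact hρ) (by positivity) ((div_le_one hsL).mpr hκL)
  have hratio : a * √μ / √L₀ ≤ 1 := by
    rw [div_le_one hsL₀]
    have : √μ ≤ √L₀ := Real.sqrt_le_sqrt (hμμ₀.trans hμ₀L₀)
    nlinarith
  have hle : a / ρ * q * √(μ / L) ≤ 1 / ρ * (κ / √L) := by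
    rw [hfac]
    exact mul_le_of_le_one_right (by positivity) hratio
  refine ⟨hf, hxs.1, by positivity, hle.trans hη1, hle, hL, hρ, ?_, hLS, fun x => ?_, fun x => ?_⟩
  · rw [← hκsq, mul_pow, div_pow, div_pow κ, Real.sq_sqrt hL.le]
    field_simp
  · have h1 := lyapunov_le_inner_gradient ha hμ₀ hμ₀L₀ hPL hAC hlo hup hμ x
    have h2 := mul_le_mul_of_nonneg_left h1 (by positivity : 0 ≤ 1 / ρ * (κ / √L))
    rw [hfac, mul_assoc]
    exact h2
  · have hF0 : 0 ≤ f x - f xs := sub_nonneg.mpr (hxs.1 x)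
    have hq1 : q ≤ 1 := Real.rpow_le_one (by positivity) ((div_le_one hL₀).mpr hμ₀L₀) (by norm_num)
    -- One factor `1/ρ` suffices since `ρ ≥ 1`; PL then gives the `grad` condition.
    have hsq : (a / ρ * q * √(μ / L)) ^ 2 ≤ μ / (ρ * L) := by
      rw [mul_pow, Real.sq_sqrt (by positivity), mul_pow, div_pow]
      have h1 : a ^ 2 / ρ ^ 2 * q ^ 2 ≤ 1 / ρ := by
        calc a ^ 2 / ρ ^ 2 * q ^ 2 ≤ 1 ^ 2 / ρ ^ 2 * 1 ^ 2 := by gcongr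
          _ = 1 / ρ * (1 / ρ) := by field_simp
          _ ≤ 1 / ρ * 1 := by gcongr; rw [div_le_one hρ0]; exact hρ
          _ = 1 / ρ := mul_one _
      calc _ ≤ 1 / ρ * (μ / L) := by gcongr
        _ = _ := by field_simp
    calc _ ≤ μ / (ρ * L) * (f x - f xs) := by gcongr
      _ = 2 * μ * (f x - f xs) / (2 * ρ * L) := by field_simp
      _ ≤ _ := by gcongr; exact hPL x

theorem theorem4p3 {d : ℕ} (hd : 0 < d) (f : Euc d → ℝ) (hf : ContDiff ℝ 1 f)
    (xs : Euc d) (hxs : IsUniqueMinimizer f xs)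
    (μ a L : ℝ) (hμ : 0 < μ) (ha : 0 < a) (ha1 : a ≤ 1) (hL : 0 < L)
    (hPL : IsPL f xs μ) (hAC : IsAiming f xs a) (hLS : IsLSmooth f L)
    (μ₀ L₀ : ℝ) (hμ₀ : μ₀ = bestQGLower f xs μ) (hL₀ : L₀ = bestQGUpper f xs L) :
    -- (i) the Nesterov ODE
    (∀ (γ : ℝ) (x z : ℝ → Euc d), 0 ≤ γ →
      IsNesterovODE f ((μ₀ * L₀) ^ (1 / 4 : ℝ)) (a * (μ₀ / L₀) ^ (1 / 4 : ℝ) * √μ)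
        γ ((μ₀ * L₀) ^ (-(1 / 4) : ℝ)) x z →
      x 0 = z 0 →
      ∀ t : ℝ, 0 ≤ t →
        f (x t) - f xs ≤ (1 + √(L₀ / μ₀)) * (f (x 0) - f xs)
          * Real.exp (-(a * (μ₀ / L₀) ^ (1 / 4 : ℝ) * √μ) * t)) ∧
    -- (ii) Nesterov's method with the continuized parameters and exact gradients
    (∀ (Ω : Type*) (_ : MeasurableSpace Ω) (P : Measure Ω) (_ : IsProbabilityMeasure P)
      (T : ℕ → Ω → ℝ) (_ : IsExpClock P T)
      (x₀ : Euc d) (x y z : ℕ → Ω → Euc d) (η η' γ γ' : ℝ),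
      η = (μ₀ * L₀) ^ (1 / 4 : ℝ) / √L →
      η' = a * (μ₀ / L₀) ^ (1 / 4 : ℝ) * √(μ / L) →
      γ = 1 / L →
      γ' = 1 / ((μ₀ * L₀) ^ (1 / 4 : ℝ) * √L) →
      (∀ ω, x 0 ω = x₀ ∧ z 0 ω = x₀) →
      (∀ ω, IsNesterovRun (fun _ v => ∇ f v)
        (fun k => continuizedAlpha η η' (T (k + 1) ω - T k ω))
        (fun k => continuizedBeta η η' (T (k + 1) ω - T k ω)) γ γ'
        (fun k => x k ω) (fun k => y k ω) (fun k => z k ω)) →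
      ∀ (c₀ c₁ : ℝ), 1 < c₀ → 0 < c₁ → c₁ < 1 → ∀ k : ℕ,
        1 - 1 / c₀ - Real.exp (-(c₁ - 1 - Real.log c₁) * k) ≤
          P.real {ω | f (x k ω) - f xs ≤ c₀ * (1 + √(L₀ / μ₀)) * (f x₀ - f xs)
            * Real.exp (-(a * (μ₀ / L₀) ^ (1 / 4 : ℝ) * √(μ / L)) * (1 - c₁) * k)}) ∧
    -- (iii) the same with stochastic gradients under the strong growth condition
    (∀ (Ω Ξ : Type*) (_ : MeasurableSpace Ω) (_ : MeasurableSpace Ξ)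
      (P : Measure Ω) (_ : IsProbabilityMeasure P) (ν : Measure Ξ) (_ : IsProbabilityMeasure ν)
      (T : ℕ → Ω → ℝ) (ξ : ℕ → Ω → Ξ) (_ : IsMarkedExpClock P ν T ξ)
      (g : Euc d → Ξ → Euc d) (ρ : ℝ) (_ : 1 ≤ ρ) (_ : IsStrongGrowthOracle f ν g ρ)
      (x₀ : Euc d) (x y z : ℕ → Ω → Euc d) (η η' γ γ' : ℝ),
      η = 1 / ρ * ((μ₀ * L₀) ^ (1 / 4 : ℝ) / √L) →
      η' = a / ρ * (μ₀ / L₀) ^ (1 / 4 : ℝ) * √(μ / L) →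
      γ = 1 / (ρ * L) →
      γ' = 1 / ρ * (1 / ((μ₀ * L₀) ^ (1 / 4 : ℝ) * √L)) →
      (∀ ω, x 0 ω = x₀ ∧ z 0 ω = x₀) →
      (∀ ω, IsNesterovRun (fun k v => g v (ξ k ω))
        (fun k => continuizedAlpha η η' (T (k + 1) ω - T k ω))
        (fun k => continuizedBeta η η' (T (k + 1) ω - T k ω)) γ γ'
        (fun k => x k ω) (fun k => y k ω) (fun k => z k ω)) →
      ∀ (c₀ c₁ : ℝ), 1 < c₀ → 0 < c₁ → c₁ < 1 → ∀ k : ℕ,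
        1 - 1 / c₀ - Real.exp (-(c₁ - 1 - Real.log c₁) * k) ≤
          P.real {ω | f (x k ω) - f xs ≤ c₀ * (1 + √(L₀ / μ₀)) * (f x₀ - f xs)
            * Real.exp (-(a / ρ * (μ₀ / L₀) ^ (1 / 4 : ℝ) * √(μ / L)) * (1 - c₁) * k)}) := by
  have hdiff : Differentiable ℝ f := hf.differentiable one_ne_zero
  have hloμ := hPL.qgLower hμ hdiff hxs
  have hupL := hLS.qgUpper hxs
  obtain ⟨hμμ₀, hlo⟩ := bestQGLower_spec hd hloμ hupL
  obtain ⟨hL₀L, hup⟩ := bestQGUpper_spec hL hupL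
  rw [← hμ₀] at hμμ₀ hlo
  rw [← hL₀] at hL₀L hup
  have hμ₀pos : 0 < μ₀ := hμ.trans_le hμμ₀
  have hμ₀L₀ : μ₀ ≤ L₀ := hlo.le_of_qgUpper hd hup
  have hL₀pos : 0 < L₀ := hμ₀pos.trans_le hμ₀L₀
  have hκpos : 0 < (μ₀ * L₀) ^ (1 / 4 : ℝ) := by positivity
  have hκsq := rpow_quarter_sq (mul_pos hμ₀pos hL₀pos).le
  have hγ' : ∀ r : ℝ, 0 < r → 1 / r * (1 / ((μ₀ * L₀) ^ (1 / 4 : ℝ) * √L)) =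
      1 / r * ((μ₀ * L₀) ^ (1 / 4 : ℝ) / √L) / √(μ₀ * L₀) := fun r hr => by
    have := Real.sqrt_pos.mpr hL
    rw [← hκsq]
    field_simp
  refine ⟨?_, ?_, ?_⟩
  · intro γ x z hγ hode h0 t ht
    have hfac : a * (μ₀ / L₀) ^ (1 / 4 : ℝ) * √μ =
        (μ₀ * L₀) ^ (1 / 4 : ℝ) * (a * √μ / √L₀) := by
      have := Real.sqrt_pos.mpr hL₀pos
      rw [← rpow_quarter_div_mul_sqrt hμ₀pos hL₀pos]
      field_simp
    have hdecay := hode.lyapunov_decay hdiff (δ := √(μ₀ * L₀)) (xs := xs) (by positivity) hγ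
      (Real.sqrt_nonneg _) (by
        rw [Real.rpow_neg (mul_pos hμ₀pos hL₀pos).le, ← hκsq]
        field_simp) (fun w => by
        rw [hfac, mul_assoc]
        exact mul_le_mul_of_nonneg_left
          (lyapunov_le_inner_gradient ha hμ₀pos hμ₀L₀ hPL hAC hlo hup hμ w) hκpos.le) ht
    refine (le_add_of_nonneg_right (by positivity)).trans (hdecay.trans ?_)
    rw [← h0]
    exact mul_le_mul_of_nonneg_right (hlo.lyapunov_init_le hμ₀pos (x 0)) (Real.exp_pos _).le
  · intro Ω _ P _ T hT x₀ x y z η η' γ γ' hη hη' hγeq hγ'eq h0 hrun c₀ c₁ hc₀ hc₁ _ k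
    have D := DescentData.of_growth hf hxs hμ ha ha1 hL hPL hAC hLS hμμ₀ hμ₀L₀ hL₀L hlo hup
      (le_refl 1)
    have h1 := hγ' 1 one_pos
    rw [div_one, one_div_one, one_mul] at D
    rw [one_div_one, one_mul, one_mul] at h1
    rw [h1, ← hη] at hγ'eq
    rw [← hη, ← hη'] at D
    rw [← hη']
    subst hγeq hγ'eq
    have hmain := D.measureReal_run_ge hT.isMarkedExpClock (IsStrongGrowthOracle.of_gradient hf _)
      h0 (by simpa only [one_mul] using hrun) (hlo.lyapunov_init_le hμ₀pos x₀)
      (zero_lt_one.trans hc₀) hc₁.le k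
    -- The exponential term of the probability is simply discarded.
    exact (sub_le_self _ (Real.exp_pos _).le).trans hmain
  · intro Ω Ξ _ _ P _ ν _ T ξ hT g ρ hρ hg x₀ x y z η η' γ γ' hη hη' hγeq hγ'eq h0 hrun
      c₀ c₁ hc₀ hc₁ _ k
    have D := DescentData.of_growth hf hxs hμ ha ha1 hL hPL hAC hLS hμμ₀ hμ₀L₀ hL₀L hlo hup hρ
    rw [hγ' ρ (by linarith), ← hη] at hγ'eq
    rw [← hη, ← hη'] at D
    rw [← hη']
    subst hγeq hγ'eq
    exact (sub_le_self _ (Real.exp_pos _).le).trans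
      (D.measureReal_run_ge hT hg h0 hrun (hlo.lyapunov_init_le hμ₀pos x₀)
        (zero_lt_one.trans hc₀) hc₁.le k)
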